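/- Let $\Omega\subset\mathbb R^3$ be a bounded Lipschitz domain and let $\mathcal T$ be a finite, geometrically conforming mesh of nondegenerate tetrahedra with $\bigcup_{T\in\mathcal T}T=\overline\Omega$. Let $p\ge 0$ be an integer, $\Delta t>0$, $\tau^\star>0$, and for each $T\in\mathcal T$ let $F^\star_T$ be an arbitrary face of $T$. Write $\mathcal P_k$ for the polynomials of total degree at most $k$ (with $\mathcal P_{-1}=\{0\}$), $\nu$ for the outward unit normal of $T$, $(\cdot,\cdot)_T$ for the $L^2(T)$ inner product of scalar, vector or matrix fields, $\langle\!\langle\cdot,\cdot\rangle\!\rangle_{\partial T}$ for the $L^2(\partial T)$ inner product, $(\cdot,\cdot)=\sum_T(\cdot,\cdot)_T$ and $\langle\!\langle\cdot,\cdot\rangle\!\rangle=\sum_T\langle\!\langle\cdot,\cdot\rangle\!\rangle_{\partial T}$. The divergence $\nabla\cdot G$ of a matrix field is taken row by row. Let $M$ be the space of all $\lambda\in[L^2(\Sigma)]^3$ on the skeleton $\Sigma$ (the union of all faces) such that $\lambda|_F\in[\mathcal P_p(F)]^3$ for every face $F$ and $\lambda|_F=0$ for every face $F\subset\partial\Omega$.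 Consider the following three methods, each given by local spaces $W_T,V_T,Q_T$ and a stabilization function $\tau$ on $\partial T$: - SFH: $W_T=[\mathcal P_p]^{3\times3}$, $V_T=[\mathcal P_p]^3$, $Q_T=\mathcal P_p$, and $\tau=\tau^\star$ on $F_T^\star$, $\tau=0$ on $\partial T\setminus F^\star_T$; - RT-H: $W_T$ consists of the matrix fields whose three rows belong to the Raviart--Thomas space $[\mathcal P_p]^3+x\,\mathcal P_p$, $V_T=[\mathcal P_p]^3$, $Q_T=\mathcal P_p$, and $\tau=0$; - BDM-H: $W_T=[\mathcal P_p]^{3\times3}$, $V_T=[\mathcal P_{p-1}]^3$, $Q_T=\mathcal P_p$, and $\tau=0$. Then for each of the three methods, each $\lambda\in M$ and each $T\in\mathcal T$, there is exactly one $(L\lambda,u\lambda,p\lambda)\in W_T\times V_T\times Q_T$ such that, for all $(G,v,q)\in W_T\times V_T\times Q_T$, $$(L\lambda,G)_T+(u\lambda,\nabla\cdot G)_T=\langle\!\langle\lambda,G\nu\rangle\!\rangle_{\partial T},$$ $$(-\nabla\cdot L\lambda+\nabla p\lambda,v)_T+\langle\!\langle\tau(u\lambda-\lambda),v\rangle\!\rangle_{\partial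 T}=0,$$ $$\tfrac1{\Delta t}(p\lambda,q)_T-(u\lambda,\nabla q)_T=-\langle\!\langle\lambda\cdot\nu,q\rangle\!\rangle_{\partial T}.$$ With the condensed augmented Lagrangian bilinear form of each method, $$a(\lambda,\mu)=(L\lambda,L\mu)+\langle\!\langle\tau(u\lambda-\lambda),u\mu-\mu\rangle\!\rangle+\tfrac1{\Delta t}(p\lambda,p\mu),$$ one has for all $\lambda,\mu\in M$ $$a_{\mathrm{BDM}}(\lambda,\mu)=a_{\mathrm{RT}}(\lambda,\mu)=a_{\mathrm{SFH}}(\lambda,\mu).$$ Moreover, on every cell $L_{\mathrm{BDM}}\lambda=L_{\mathrm{RT}}\lambda=L_{\mathrm{SFH}}\lambda$ and $p_{\mathrm{BDM}}\lambda=p_{\mathrm{RT}}\lambda=p_{\mathrm{SFH}}\lambda$, and the stabilization term $\langle\!\langle\tau(u\lambda-\lambda),u\mu-\mu\rangle\!\rangle$ is zero for each of the three methods. -/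

import Mathlib

open MeasureTheory

noncomputable section

namespace StokesHDG

/-- Three-dimensional Euclidean space. -/
abbrev E3 : Type := EuclideanSpace ℝ (Fin 3)

/-- Real polynomials in the three Cartesian coordinates. On a nondegenerate tetrahedron a polynomial
function and its polynomial determine each other. -/
abbrev Poly3 : Type := MvPolynomial (Fin 3) ℝ

/-! ### Meshes -/

/-- A finite, geometrically conforming tetrahedral mesh of `Ω`: a finite simplicial complex all of
whose simplices are faces of tetrahedra of the complex and whose tetrahedra cover the closure
of `Ω`. A simplex is represented by the finite set of its vertices. -/
structure TetMesh (Ω : Set E3) where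
  complex : Geometry.SimplicialComplex ℝ E3
  finite : complex.faces.Finite
  pure : ∀ s ∈ complex.faces, ∃ t ∈ complex.faces, s ⊆ t ∧ t.card = 4
  closure_eq : closure Ω = complex.space

/-- The closed simplex with the given vertices. -/
def hull (s : Finset E3) : Set E3 := convexHull ℝ (s : Set E3)

/-- The cells (tetrahedra) of a mesh. -/
def TetMesh.cells {Ω : Set E3} (mesh : TetMesh Ω) : Finset (Finset E3) :=
  mesh.finite.toFinset.filter fun T => T.card = 4

/-- The (two-dimensional, triangular) faces of a mesh. -/
def TetMesh.faces {Ω : Set E3} (mesh : TetMesh Ω) : Finset (Finset E3) :=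
  mesh.finite.toFinset.filter fun F => F.card = 3

/-- The Dirichlet faces: the faces that lie on the boundary of `Ω`. -/
def TetMesh.IsDirichlet {Ω : Set E3} (_mesh : TetMesh Ω) (F : Finset E3) : Prop :=
  hull F ⊆ frontier Ω

/-- The skeleton: the union of all faces. -/
def TetMesh.skeleton {Ω : Set E3} (mesh : TetMesh Ω) : Set E3 :=
  ⋃ F ∈ mesh.faces, hull F

/-- The four triangular faces of a single cell; `∂T` is their union. -/
def facesOf (T : Finset E3) : Finset (Finset E3) := T.powersetCard 3

/-- The barycenter of a simplex. -/
def barycenter (s : Finset E3) : E3 := (s.card : ℝ)⁻¹ • ∑ v ∈ s, v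

/-- The component orthogonal to the plane of `F` of the vector that points from the barycenter of
the cell `T` to the barycenter of its face `F`. -/
def normalDir (T F : Finset E3) : E3 :=
  ((vectorSpan ℝ (F : Set E3))ᗮ).starProjection (barycenter F - barycenter T)

/-- The unit normal on the face `F` of the cell `T` that points out of `T`. -/
def outerNormal (T F : Finset E3) : E3 := ‖normalDir T F‖⁻¹ • normalDir T F

/-- The surface measure: two-dimensional Hausdorff measure, normalized so that it is the Lebesgue
measure on planes. -/
def surfaceMeasure : Measure E3 := μHE[2]

/-! ### Polynomials and polynomial spaces -/

/-- The value of a polynomial at a point. -/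
def pval (q : Poly3) (x : E3) : ℝ := MvPolynomial.eval (fun i => x i) q

/-- The gradient of a polynomial. -/
def grad (q : Poly3) : Fin 3 → Poly3 := fun i => MvPolynomial.pderiv i q

/-- The row-wise divergence of a matrix-valued polynomial. -/
def divergence (G : Matrix (Fin 3) (Fin 3) Poly3) : Fin 3 → Poly3 :=
  fun i => ∑ j, MvPolynomial.pderiv j (G i j)

/-- Polynomials of total degree at most `k`; this is the zero space for `k < 0`. -/
def polySpace (k : ℤ) : Submodule ℝ Poly3 :=
  MvPolynomial.restrictSupport ℝ {n : Fin 3 →₀ ℕ | (n.degree : ℤ) ≤ k}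

/-- Vector fields whose three components are polynomials of degree at most `k`. -/
def vecPolySpace (k : ℤ) : Submodule ℝ (Fin 3 → Poly3) :=
  Submodule.pi Set.univ fun _ => polySpace k

/-- Matrix fields all of whose rows belong to a given space of vector fields. -/
def rowwise (R : Submodule ℝ (Fin 3 → Poly3)) :
    Submodule ℝ (Matrix (Fin 3) (Fin 3) Poly3) where
  carrier := {G | ∀ i, G i ∈ R}
  add_mem' hG hH i := R.add_mem (hG i) (hH i)
  zero_mem' _ := R.zero_mem
  smul_mem' c _ hG i := R.smul_mem c (hG i)

/-- The Raviart--Thomas space `[P_p]³ + x P_p`. -/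
def raviartThomas (p : ℕ) : Submodule ℝ (Fin 3 → Poly3) :=
  vecPolySpace p ⊔
    (polySpace p).map (LinearMap.pi fun j => LinearMap.mulLeft ℝ (MvPolynomial.X j : Poly3))

/-! ### The trace space -/

/-- The space `M` of traces: the square integrable vector fields on the skeleton that are polynomial
of degree at most `p` on each face and vanish on the Dirichlet faces. -/
def traceSpace {Ω : Set E3} (mesh : TetMesh Ω) (p : ℕ) :
    Submodule ℝ (Lp E3 2 (surfaceMeasure.restrict mesh.skeleton)) where
  carrier := {lam |
    (∀ F ∈ mesh.faces, ∃ q ∈ vecPolySpace p,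
      ∀ᵐ x ∂(surfaceMeasure.restrict (hull F)), ∀ i, lam x i = pval (q i) x) ∧
    (∀ F ∈ mesh.faces, mesh.IsDirichlet F →
      ∀ᵐ x ∂(surfaceMeasure.restrict (hull F)), lam x = 0)}
  add_mem' := by
    rintro a b ⟨ha, ha'⟩ ⟨hb, hb'⟩
    have key : ∀ F ∈ mesh.faces, ∀ᵐ x ∂(surfaceMeasure.restrict (hull F)),
        (a + b : Lp E3 2 (surfaceMeasure.restrict mesh.skeleton)) x = a x + b x := fun F hF =>
      ae_restrict_of_ae_restrict_of_subset (Set.subset_biUnion_of_mem (u := hull) hF)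
        (Lp.coeFn_add a b)
    refine ⟨fun F hF => ?_, fun F hF hD => ?_⟩
    · obtain ⟨q, hq, h1⟩ := ha F hF
      obtain ⟨r, hr, h2⟩ := hb F hF
      refine ⟨q + r, Submodule.add_mem _ hq hr, ?_⟩
      filter_upwards [key F hF, h1, h2] with x h h1 h2 i
      rw [h]
      simp [h1 i, h2 i, pval]
    · filter_upwards [key F hF, ha' F hF hD, hb' F hF hD] with x h h1 h2
      rw [h, h1, h2, add_zero]
  zero_mem' := by
    have key : ∀ F ∈ mesh.faces, ∀ᵐ x ∂(surfaceMeasure.restrict (hull F)),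
        (0 : Lp E3 2 (surfaceMeasure.restrict mesh.skeleton)) x = 0 := fun F hF =>
      ae_restrict_of_ae_restrict_of_subset (Set.subset_biUnion_of_mem (u := hull) hF)
        (Lp.coeFn_zero E3 2 _)
    refine ⟨fun F hF => ⟨0, Submodule.zero_mem _, ?_⟩, fun F hF _ => key F hF⟩
    filter_upwards [key F hF] with x h i
    rw [h]
    simp [pval]
  smul_mem' := by
    rintro c a ⟨ha, ha'⟩
    have key : ∀ F ∈ mesh.faces, ∀ᵐ x ∂(surfaceMeasure.restrict (hull F)),
        (c • a : Lp E3 2 (surfaceMeasure.restrict mesh.skeleton)) x = c • a x := fun F hF =>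
      ae_restrict_of_ae_restrict_of_subset (Set.subset_biUnion_of_mem (u := hull) hF)
        (Lp.coeFn_smul c a)
    refine ⟨fun F hF => ?_, fun F hF hD => ?_⟩
    · obtain ⟨q, hq, h1⟩ := ha F hF
      refine ⟨c • q, Submodule.smul_mem _ c hq, ?_⟩
      filter_upwards [key F hF, h1] with x h h1 i
      simp [h, h1 i, pval]
    · filter_upwards [key F hF, ha' F hF hD] with x h h1
      simp [h, h1]

/-! ### The three methods -/

/-- A choice of local approximation spaces `W` (gradient), `V` (velocity), `Q` (pressure), the same
on every cell, and of the stabilization: `S = stab T F • 1` on the face `F` of the cell `T`. -/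
structure Method where
  W : Submodule ℝ (Matrix (Fin 3) (Fin 3) Poly3)
  V : Submodule ℝ (Fin 3 → Poly3)
  Q : Submodule ℝ Poly3
  stab : Finset E3 → Finset E3 → ℝ

open scoped Classical in
/-- The single face hybridizable method with stabilization parameter `τ` on the chosen face
`Fstar T` of each cell `T`, and `0` on the other faces. -/
def sfh (p : ℕ) (τ : ℝ) (Fstar : Finset E3 → Finset E3) : Method where
  W := rowwise (vecPolySpace p)
  V := vecPolySpace p
  Q := polySpace p
  stab T F := if F = Fstar T then τ else 0

/-- The hybrid Raviart--Thomas method. -/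
def rtH (p : ℕ) : Method where
  W := rowwise (raviartThomas p)
  V := vecPolySpace p
  Q := polySpace p
  stab _ _ := 0

/-- The hybrid Brezzi--Douglas--Marini method. -/
def bdmH (p : ℕ) : Method where
  W := rowwise (vecPolySpace p)
  V := vecPolySpace ((p : ℤ) - 1)
  Q := polySpace p
  stab _ _ := 0

/-! ### Local solvers -/

/-- A triple `(L, u, p)` of polynomial fields on a cell. -/
structure LocalTriple where
  L : Matrix (Fin 3) (Fin 3) Poly3
  u : Fin 3 → Poly3
  p : Poly3

instance : Nonempty LocalTriple := ⟨⟨0, 0, 0⟩⟩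

/-- `(p, q)_T` for scalar fields. -/
def innerS (T : Finset E3) (p q : Poly3) : ℝ := ∫ x in hull T, pval p x * pval q x

/-- `(u, v)_T` for vector fields. -/
def innerV (T : Finset E3) (u v : Fin 3 → Poly3) : ℝ :=
  ∫ x in hull T, ∑ i, pval (u i) x * pval (v i) x

/-- `(L, G)_T` for matrix fields. -/
def innerM (T : Finset E3) (L G : Matrix (Fin 3) (Fin 3) Poly3) : ℝ :=
  ∫ x in hull T, ∑ i, ∑ j, pval (L i j) x * pval (G i j) x

/-- `∫_{∂T} g dσ`, where the integrand may depend on the face, as the outer normal does. -/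
def boundaryIntegral (T : Finset E3) (g : Finset E3 → E3 → ℝ) : ℝ :=
  ∑ F ∈ facesOf T, ∫ x in hull F, g F x ∂surfaceMeasure

/-- The element-local problem on the cell `T` with boundary data `lam`. -/
structure IsLocalSolution (m : Method) (dt : ℝ) (T : Finset E3) (lam : E3 → E3)
    (s : LocalTriple) : Prop where
  L_mem : s.L ∈ m.W
  u_mem : s.u ∈ m.V
  p_mem : s.p ∈ m.Q
  /-- `(L, G)_T + (u, ∇·G)_T = ⟪lam, G ν⟫_∂T` -/
  gradient_eq : ∀ G ∈ m.W,
    innerM T s.L G + innerV T s.u (divergence G) =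
      boundaryIntegral T fun F x =>
        ∑ i, lam x i * ∑ j, pval (G i j) x * outerNormal T F j
  /-- `(-∇·L + ∇p, v)_T + ⟪S (u - lam), v⟫_∂T = 0` -/
  momentum_eq : ∀ v ∈ m.V,
    innerV T (-divergence s.L + grad s.p) v +
      boundaryIntegral T (fun F x =>
        ∑ i, m.stab T F * (pval (s.u i) x - lam x i) * pval (v i) x) = 0
  /-- `(1/Δt) (p, q)_T - (u, ∇q)_T = -⟪lam·ν, q⟫_∂T` -/
  balance_eq : ∀ q ∈ m.Q,
    1 / dt * innerS T s.p q - innerV T s.u (grad q) =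
      -boundaryIntegral T fun F x => (∑ i, lam x i * outerNormal T F i) * pval q x

/-- The local solver: the solution of the element-local problem (an arbitrary triple if there is
no solution). -/
def localSolver (m : Method) (dt : ℝ) (T : Finset E3) (lam : E3 → E3) : LocalTriple :=
  Classical.epsilon (IsLocalSolution m dt T lam)

/-! ### The condensed bilinear form -/

/-- `(L lam, L mu)`, with `(·, ·)` assembled from the cells. -/
def gradientTerm {Ω : Set E3} (mesh : TetMesh Ω) (m : Method) (dt : ℝ) (lam mu : E3 → E3) : ℝ :=
  ∑ T ∈ mesh.cells, innerM T (localSolver m dt T lam).L (localSolver m dt T mu).L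

/-- `⟪S (u lam - lam), u mu - mu⟫`, where interior faces are counted from both sides. -/
def stabilizationTerm {Ω : Set E3} (mesh : TetMesh Ω) (m : Method) (dt : ℝ)
    (lam mu : E3 → E3) : ℝ :=
  ∑ T ∈ mesh.cells, boundaryIntegral T fun F x =>
    ∑ i, m.stab T F * (pval ((localSolver m dt T lam).u i) x - lam x i) *
      (pval ((localSolver m dt T mu).u i) x - mu x i)

/-- `(p lam, p mu)`, with `(·, ·)` assembled from the cells. -/
def pressureTerm {Ω : Set E3} (mesh : TetMesh Ω) (m : Method) (dt : ℝ) (lam mu : E3 → E3) : ℝ :=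
  ∑ T ∈ mesh.cells, innerS T (localSolver m dt T lam).p (localSolver m dt T mu).p

/-- The condensed augmented Lagrangian bilinear form
`a(lam, mu) = (L lam, L mu) + ⟪S (u lam - lam), u mu - mu⟫ + (1/Δt) (p lam, p mu)`. -/
def aForm {Ω : Set E3} (mesh : TetMesh Ω) (m : Method) (dt : ℝ) (lam mu : E3 → E3) : ℝ :=
  gradientTerm mesh m dt lam mu + stabilizationTerm mesh m dt lam mu +
    1 / dt * pressureTerm mesh m dt lam mu

end StokesHDG

end

/-!
The stabilization never acts. Test the momentum equation with `v = ω (-∇·L + ∇p)`, where `ω = 1` for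
BDM-H and RT-H, and where for SFH `ω` is the barycentric coordinate of the vertex opposite to the
stabilized face: it vanishes on that face, is positive inside the cell, and raises the degree by one
only. Hence `∇·L = ∇p` for all three methods. In particular `∇·L` has degree at most `p - 1`, and a
Raviart--Thomas field with such a divergence lies in `[P_p]³`. So all three methods solve the local
problem in which the velocity is an arbitrary polynomial field, and this problem determines `L` and
`p`: the difference of two solutions satisfies
`(dL, dL)_T + (1/Δt) (dp, dp)_T = (du, ∇dp - ∇·dL)_T = 0`.

The velocity of a homogeneous solution is orthogonal to the divergences of `W`, which make up `V`
for BDM-H and RT-H. For SFH the only term left in the momentum equation is the stabilization, which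
forces `u = λ` on the stabilized face. This makes the stabilization term vanish, and for `λ = 0` it
gives `u = ω w` with `w` of degree at most `p - 1`; then `w` is the divergence of a field of `W`,
and `(ω w, w)_T = 0`. Uniqueness gives existence because the local problems are square.
-/

noncomputable section

namespace StokesHDG

open MvPolynomial

/-! ### Polynomial spaces -/

theorem mem_polySpace {k : ℤ} {q : Poly3} :
    q ∈ polySpace k ↔ ∀ n, coeff n q ≠ 0 → (n.degree : ℤ) ≤ k := by
  simp only [polySpace, mem_restrictSupport_iff, Set.subset_def, Finset.mem_coe, mem_support_iff]
  rfl

theorem mem_polySpace_iff_totalDegree_le {k : ℤ} {q : Poly3} (hq : q ≠ 0) :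
    q ∈ polySpace k ↔ (q.totalDegree : ℤ) ≤ k := by
  obtain ⟨n, hn, hmax⟩ := Finset.exists_mem_eq_sup _ (support_nonempty.2 hq) Finsupp.degree
  have hdeg : q.totalDegree = n.degree := hmax
  rw [mem_polySpace, hdeg]
  refine ⟨fun h => h n (mem_support_iff.1 hn), fun h m hm => le_trans ?_ h⟩
  exact_mod_cast hdeg ▸ le_totalDegree (mem_support_iff.2 hm)

theorem polySpace_mono : Monotone polySpace :=
  fun _ _ h => restrictSupport_mono ℝ fun _ hn => le_trans hn h

theorem polySpace_fg (k : ℤ) : (polySpace k).FG := by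
  have hfin : {n : Fin 3 →₀ ℕ | (n.degree : ℤ) ≤ k}.Finite :=
    (Finsupp.finite_of_degree_le (σ := Fin 3) k.toNat).subset fun n (hn : (n.degree : ℤ) ≤ k) =>
      show n.degree ≤ k.toNat by lia
  rw [polySpace, restrictSupport_eq_span]
  exact Submodule.fg_span (hfin.image _)

theorem monomial_mem_polySpace {k : ℤ} {n : Fin 3 →₀ ℕ} (h : (n.degree : ℤ) ≤ k) (c : ℝ) :
    monomial n c ∈ polySpace k :=
  (monomial_mem_restrictSupport ℝ).2 (Or.inl h)

theorem C_mem_polySpace (c : ℝ) : (C c : Poly3) ∈ polySpace 0 :=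
  monomial_mem_polySpace (by simp) c

theorem X_mem_polySpace (i : Fin 3) : (X i : Poly3) ∈ polySpace 1 :=
  monomial_mem_polySpace (by simp) 1

open scoped Pointwise in
theorem mul_mem_polySpace {j k : ℤ} {a b : Poly3} (ha : a ∈ polySpace j) (hb : b ∈ polySpace k) :
    a * b ∈ polySpace (j + k) := by
  have hadd : {n : Fin 3 →₀ ℕ | (n.degree : ℤ) ≤ j} + {n : Fin 3 →₀ ℕ | (n.degree : ℤ) ≤ k} ⊆
      {n : Fin 3 →₀ ℕ | (n.degree : ℤ) ≤ j + k} := by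
    rintro _ ⟨m, hm, n, hn, rfl⟩
    simpa using add_le_add (α := ℤ) hm hn
  exact restrictSupport_mono ℝ hadd (restrictSupport_add ℝ _ _ ▸ Submodule.mul_mem_mul ha hb)

theorem pderiv_mem_polySpace {k : ℤ} {q : Poly3} (hq : q ∈ polySpace k) (i : Fin 3) :
    pderiv i q ∈ polySpace (k - 1) := by
  rw [mem_polySpace] at *
  intro n hn
  rw [coeff_pderiv] at hn
  have := hq _ (left_ne_zero_of_mul hn)
  rw [map_add, Finsupp.degree_single] at this
  lia

theorem mem_vecPolySpace {k : ℤ} {v : Fin 3 → Poly3} :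
    v ∈ vecPolySpace k ↔ ∀ i, v i ∈ polySpace k := by
  simp [vecPolySpace]

theorem vecPolySpace_mono : Monotone vecPolySpace := fun _ _ h _ hv =>
  mem_vecPolySpace.2 fun i => polySpace_mono h (mem_vecPolySpace.1 hv i)

theorem vecPolySpace_fg (k : ℤ) : (vecPolySpace k).FG :=
  Submodule.fg_pi fun _ => polySpace_fg k

theorem raviartThomas_fg (p : ℕ) : (raviartThomas p).FG :=
  (vecPolySpace_fg p).sup ((polySpace_fg p).map _)

theorem rowwise_fg {R : Submodule ℝ (Fin 3 → Poly3)} (hR : R.FG) : (rowwise R).FG := by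
  have heq : rowwise R =
      Submodule.pi (φ := fun _ : Fin 3 => Fin 3 → Poly3) Set.univ fun _ => R := by
    ext G
    exact (Set.mem_univ_pi (t := fun _ => (R : Set (Fin 3 → Poly3)))).symm
  exact heq ▸ Submodule.fg_pi fun _ => hR

theorem rowwise_mono : Monotone rowwise := fun _ _ h _ hG i => h (hG i)

/-! ### Divergence and gradient -/

/-- The divergence of a vector field, as a linear map. -/
def vecDivergence : (Fin 3 → Poly3) →ₗ[ℝ] Poly3 where
  toFun v := ∑ j, pderiv j (v j)
  map_add' v w := by simp [Finset.sum_add_distrib]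
  map_smul' c v := by simp [Finset.smul_sum]

/-- `divergence` as a linear map. -/
def divergenceₗ : Matrix (Fin 3) (Fin 3) Poly3 →ₗ[ℝ] Fin 3 → Poly3 where
  toFun := divergence
  map_add' G H := funext fun i => vecDivergence.map_add (G i) (H i)
  map_smul' c G := funext fun i => vecDivergence.map_smul c (G i)

/-- `grad` as a linear map. -/
def gradₗ : Poly3 →ₗ[ℝ] Fin 3 → Poly3 := LinearMap.pi fun i => (pderiv i).toLinearMap

theorem divergenceₗ_apply (G : Matrix (Fin 3) (Fin 3) Poly3) : divergenceₗ G = divergence G :=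
  rfl

theorem gradₗ_apply (q : Poly3) : gradₗ q = grad q :=
  rfl

/-- The vector field `x c` for a scalar field `c`. -/
def radialField : Poly3 →ₗ[ℝ] Fin 3 → Poly3 := LinearMap.pi fun j => LinearMap.mulLeft ℝ (X j)

theorem radialField_mem_vecPolySpace {k : ℤ} {c : Poly3} (hc : c ∈ polySpace (k - 1)) :
    radialField c ∈ vecPolySpace k :=
  mem_vecPolySpace.2 fun j => by
    have := mul_mem_polySpace (X_mem_polySpace j) hc
    rwa [add_sub_cancel] at this

theorem mem_raviartThomas {p : ℕ} {r : Fin 3 → Poly3} :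
    r ∈ raviartThomas p ↔ ∃ a ∈ vecPolySpace p, ∃ c ∈ polySpace p, a + radialField c = r := by
  simp only [raviartThomas, Submodule.mem_sup, Submodule.mem_map, exists_exists_and_eq_and]
  rfl

theorem radialField_mem_raviartThomas {p : ℕ} {c : Poly3} (hc : c ∈ polySpace p) :
    radialField c ∈ raviartThomas p :=
  Submodule.mem_sup_right ⟨c, hc, rfl⟩

theorem coeff_sum_pderiv_X_mul {σ R : Type*} [Fintype σ] [CommSemiring R] (n : σ →₀ ℕ)
    (c : MvPolynomial σ R) :
    coeff n (∑ j, pderiv j (X j * c)) = (n.degree + Fintype.card σ) * coeff n c := by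
  have hterm (j : σ) : coeff n (pderiv j (X j * c)) = (n j + 1) * coeff n c := by
    rw [coeff_pderiv, mul_comm (X j), coeff_mul_X, mul_comm]
  simp only [coeff_sum, hterm, ← Finset.sum_mul, Finset.sum_add_distrib, Finsupp.degree_eq_sum,
    Nat.cast_sum, Finset.sum_const, Finset.card_univ, nsmul_eq_mul, mul_one]

theorem coeff_vecDivergence_radialField (n : Fin 3 →₀ ℕ) (c : Poly3) :
    coeff n (vecDivergence (radialField c)) = (n.degree + 3) * coeff n c := by
  exact_mod_cast coeff_sum_pderiv_X_mul n c

theorem vecDivergence_radialField_mem_polySpace {k : ℤ} {c : Poly3} :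
    vecDivergence (radialField c) ∈ polySpace k ↔ c ∈ polySpace k := by
  have hne (n : Fin 3 →₀ ℕ) : (n.degree : ℝ) + 3 ≠ 0 := by positivity
  simp only [mem_polySpace, coeff_vecDivergence_radialField, mul_ne_zero_iff, hne, ne_eq,
    not_false_eq_true, true_and]

theorem exists_vecDivergence_radialField_eq (b : Poly3) :
    ∃ c, vecDivergence (radialField c) = b := by
  refine ⟨∑ n ∈ b.support, monomial n (coeff n b / (n.degree + 3)), ?_⟩
  ext n
  have hne : (n.degree : ℝ) + 3 ≠ 0 := by positivity
  simp only [coeff_vecDivergence_radialField, coeff_sum, coeff_monomial, Finset.sum_ite_eq',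
    mem_support_iff]
  split_ifs with hn
  · field_simp
  · simp [not_not.1 hn]

theorem exists_divergence_eq {R : Submodule ℝ (Fin 3 → Poly3)} {k : ℤ}
    (hR : ∀ c ∈ polySpace k, radialField c ∈ R) {v : Fin 3 → Poly3} (hv : v ∈ vecPolySpace k) :
    ∃ G ∈ rowwise R, divergence G = v := by
  choose c hc using fun i => exists_vecDivergence_radialField_eq (v i)
  refine ⟨fun i => radialField (c i), fun i => hR _ ?_, funext hc⟩
  rw [← vecDivergence_radialField_mem_polySpace, hc i]
  exact mem_vecPolySpace.1 hv i

theorem vecDivergence_mem_polySpace {k : ℤ} {v : Fin 3 → Poly3} (hv : v ∈ vecPolySpace k) :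
    vecDivergence v ∈ polySpace (k - 1) :=
  Submodule.sum_mem _ fun j _ => pderiv_mem_polySpace (mem_vecPolySpace.1 hv j) j

theorem divergence_mem_vecPolySpace {k : ℤ} {G : Matrix (Fin 3) (Fin 3) Poly3}
    (hG : G ∈ rowwise (vecPolySpace k)) : divergence G ∈ vecPolySpace (k - 1) :=
  mem_vecPolySpace.2 fun i => vecDivergence_mem_polySpace (hG i)

theorem grad_mem_vecPolySpace {k : ℤ} {q : Poly3} (hq : q ∈ polySpace k) :
    grad q ∈ vecPolySpace (k - 1) :=
  mem_vecPolySpace.2 fun i => pderiv_mem_polySpace hq i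

theorem vecDivergence_mem_of_raviartThomas {p : ℕ} {r : Fin 3 → Poly3}
    (hr : r ∈ raviartThomas p) : vecDivergence r ∈ polySpace p := by
  obtain ⟨a, ha, c, hc, rfl⟩ := mem_raviartThomas.1 hr
  rw [map_add]
  exact add_mem (polySpace_mono (by lia) (vecDivergence_mem_polySpace ha))
    (vecDivergence_radialField_mem_polySpace.2 hc)

theorem divergence_mem_of_raviartThomas {p : ℕ} {G : Matrix (Fin 3) (Fin 3) Poly3}
    (hG : G ∈ rowwise (raviartThomas p)) : divergence G ∈ vecPolySpace p :=
  mem_vecPolySpace.2 fun i => vecDivergence_mem_of_raviartThomas (hG i)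

theorem mem_vecPolySpace_of_vecDivergence_mem {p : ℕ} {r : Fin 3 → Poly3}
    (hr : r ∈ raviartThomas p) (hdiv : vecDivergence r ∈ polySpace ((p : ℤ) - 1)) :
    r ∈ vecPolySpace p := by
  obtain ⟨a, ha, c, -, rfl⟩ := mem_raviartThomas.1 hr
  rw [map_add, Submodule.add_mem_iff_right _ (vecDivergence_mem_polySpace ha),
    vecDivergence_radialField_mem_polySpace] at hdiv
  exact add_mem ha (radialField_mem_vecPolySpace hdiv)

/-! ### Affine functions as divisors -/

theorem dvd_sub_map_of_forall_dvd_X_sub {σ R : Type*} [CommRing R] {l : MvPolynomial σ R}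
    {φ : MvPolynomial σ R →ₐ[R] MvPolynomial σ R} (h : ∀ i, l ∣ X i - φ (X i))
    (q : MvPolynomial σ R) : l ∣ q - φ q := by
  have heq : Ideal.Quotient.mkₐ R (Ideal.span {l}) =
      (Ideal.Quotient.mkₐ R (Ideal.span {l})).comp φ :=
    algHom_ext fun i => (Ideal.Quotient.mk_eq_mk_iff_sub_mem _ _).2
      (Ideal.mem_span_singleton.2 (h i))
  exact Ideal.mem_span_singleton.1
    ((Ideal.Quotient.mk_eq_mk_iff_sub_mem _ _).1 (DFunLike.congr_fun heq q))

theorem eq_zero_of_forall_pval_eq_zero {q : Poly3} (h : ∀ x, pval q x = 0) : q = 0 :=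
  MvPolynomial.funext fun x => by simpa [pval] using h (WithLp.toLp 2 x)

/-- The polynomial of degree at most one whose function is the affine function `f`. -/
def affinePoly (f : E3 →ᵃ[ℝ] ℝ) : Poly3 :=
  C (f 0) + ∑ i, C (f.linear (EuclideanSpace.single i 1)) * X i

theorem pval_affinePoly (f : E3 →ᵃ[ℝ] ℝ) (x : E3) : pval (affinePoly f) x = f x := by
  have hlinear : f.linear x = ∑ i, f.linear (EuclideanSpace.single i 1) * x i := by
    conv_lhs => rw [← (EuclideanSpace.basisFun (Fin 3) ℝ).sum_repr x]
    simp [mul_comm]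
  rw [AffineMap.decomp f, Pi.add_apply, hlinear]
  simp [affinePoly, pval, add_comm]

theorem affinePoly_mem_polySpace (f : E3 →ᵃ[ℝ] ℝ) : affinePoly f ∈ polySpace 1 :=
  add_mem (polySpace_mono zero_le_one (C_mem_polySpace _)) <| sum_mem fun i _ => by
    simpa using mul_mem_polySpace (C_mem_polySpace _) (X_mem_polySpace i)

theorem pval_bind₁ (r : Fin 3 → Poly3) (q : Poly3) (x : E3) :
    pval (bind₁ r q) x = pval q (WithLp.toLp 2 fun i => pval (r i) x) :=
  eval₂Hom_bind₁ _ _ _ _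

section Divisibility

variable {f : E3 →ᵃ[ℝ] ℝ}

theorem totalDegree_affinePoly_pos (hf : f.linear ≠ 0) : 0 < (affinePoly f).totalDegree := by
  refine Nat.pos_of_ne_zero fun h => hf (f.linear_eq_zero_iff_exists_const.2 ⟨f 0, ?_⟩)
  rw [totalDegree_eq_zero_iff_eq_C] at h
  ext x
  rw [AffineMap.const_apply, ← pval_affinePoly f x, ← pval_affinePoly f 0, h]
  simp [pval]

theorem affinePoly_ne_zero (hf : f.linear ≠ 0) : affinePoly f ≠ 0 := fun h => by
  simpa [h] using totalDegree_affinePoly_pos hf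

/-- The shear `x ↦ x - f(x) d` with `f.linear d = 1` projects onto the plane `f = 0` and is the
identity modulo `f`. -/
theorem affinePoly_dvd (hf : f.linear ≠ 0) {q : Poly3} (hq : ∀ x, f x = 0 → pval q x = 0) :
    affinePoly f ∣ q := by
  obtain ⟨d, hd⟩ : ∃ d, f.linear d = 1 := LinearMap.surjective hf 1
  set φ : Poly3 →ₐ[ℝ] Poly3 := bind₁ fun i => X i - affinePoly f * C (d i) with hφ
  have hφq : φ q = 0 := eq_zero_of_forall_pval_eq_zero fun x => by
    rw [hφ, pval_bind₁]
    refine hq _ ?_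
    have hx : (WithLp.toLp 2 fun i => pval (X i - affinePoly f * C (d i)) x) =
        -(f x • d) +ᵥ x := by
      ext i
      simp [← pval_affinePoly f x, pval, add_comm, sub_eq_add_neg]
    rw [hx, AffineMap.map_vadd]
    simp [hd]
  have h := dvd_sub_map_of_forall_dvd_X_sub (φ := φ) (l := affinePoly f)
    (fun i => ⟨C (d i), by simp [hφ]⟩) q
  rwa [hφq, sub_zero] at h

theorem mem_polySpace_of_affinePoly_mul_mem (hf : f.linear ≠ 0) {k : ℤ} {w : Poly3}
    (hw : affinePoly f * w ∈ polySpace k) : w ∈ polySpace (k - 1) := by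
  obtain rfl | hw0 := eq_or_ne w 0
  · exact zero_mem _
  have hne := affinePoly_ne_zero hf
  rw [mem_polySpace_iff_totalDegree_le (mul_ne_zero hne hw0),
    totalDegree_mul_of_isDomain hne hw0] at hw
  rw [mem_polySpace_iff_totalDegree_le hw0]
  have := totalDegree_affinePoly_pos hf
  lia

end Divisibility

/-! ### Hausdorff measure on convex sets -/

section ConvexSets

variable {E : Type*} [NormedAddCommGroup E] [InnerProductSpace ℝ E]

/-- The isometric parametrization `v ↦ v + a` of an affine subspace `A` by its direction. -/
def affineChart {A : AffineSubspace ℝ E} (a : A) : A.direction →ᵃⁱ[ℝ] E :=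
  haveI : Nonempty A := ⟨a⟩
  A.subtypeₐᵢ.comp (AffineIsometryEquiv.vaddConst ℝ a).toAffineIsometry

variable {A : AffineSubspace ℝ E} {C : Set E}

theorem affineChart_apply (a : A) (v : A.direction) : affineChart a v = v + a := rfl

theorem range_affineChart (a : A) : Set.range (affineChart a) = A := by
  ext x
  refine ⟨?_, fun hx => ⟨⟨x -ᵥ a, A.vsub_mem_direction hx a.2⟩, by simp [affineChart_apply]⟩⟩
  rintro ⟨v, rfl⟩
  exact AffineSubspace.vadd_mem_of_mem_direction v.2 a.2

theorem interior_affineChart_preimage_nonempty [FiniteDimensional ℝ E] (hC : Convex ℝ C)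
    (a : affineSpan ℝ C) : (interior (affineChart a ⁻¹' C)).Nonempty := by
  have : Nonempty (affineSpan ℝ C) := ⟨a⟩
  have hne : C.Nonempty := (affineSpan_nonempty ℝ).1 ⟨a.1, a.2⟩
  obtain ⟨-, y, hy, -⟩ := hne.intrinsicInterior hC
  let e := (AffineIsometryEquiv.vaddConst ℝ a).toHomeomorph
  refine ⟨e.symm y, ?_⟩
  change _ ∈ interior (e ⁻¹' (Subtype.val ⁻¹' C))
  rwa [← e.preimage_interior, Set.mem_preimage, e.apply_symm_apply]

variable [FiniteDimensional ℝ E] [MeasurableSpace E] [BorelSpace E]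

theorem euclideanHausdorffMeasure_restrict_eq_map (hC : C ⊆ A) (a : A) :
    (μHE[Module.finrank ℝ A.direction]).restrict C =
      (volume.restrict (affineChart a ⁻¹' C)).map (affineChart a) := by
  have hemb : MeasurableEmbedding (affineChart a) :=
    (affineChart a).isometry.isClosedEmbedding.measurableEmbedding
  rw [← hemb.restrict_map, ← InnerProductSpace.euclideanHausdorffMeasure_eq_volume,
    (affineChart a).isometry.map_euclideanHausdorffMeasure, range_affineChart,
    Measure.restrict_restrict_of_subset hC]

theorem euclideanHausdorffMeasure_lt_top (hC : Bornology.IsBounded C) :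
    μHE[Module.finrank ℝ (vectorSpan ℝ C)] C < ⊤ := by
  obtain rfl | ⟨x, hx⟩ := C.eq_empty_or_nonempty
  · simp
  let a : affineSpan ℝ C := ⟨x, subset_affineSpan ℝ C hx⟩
  have hbdd : Bornology.IsBounded (affineChart a ⁻¹' C) :=
    (affineChart a).isometry.antilipschitz.isBounded_preimage hC
  rw [← direction_affineSpan, ← Measure.restrict_apply_univ,
    euclideanHausdorffMeasure_restrict_eq_map (subset_affineSpan ℝ C) a,
    Measure.map_apply (affineChart a).continuous.measurable .univ]
  simpa using hbdd.measure_lt_top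

theorem eq_zero_on_affineSpan_of_ae_eq_zero (hC : Convex ℝ C) {f : E → ℝ}
    (hf : AnalyticOnNhd ℝ f Set.univ)
    (hae : ∀ᵐ x ∂(μHE[Module.finrank ℝ (vectorSpan ℝ C)]).restrict C, f x = 0)
    {x : E} (hx : x ∈ affineSpan ℝ C) : f x = 0 := by
  let φ := affineChart (⟨x, hx⟩ : affineSpan ℝ C)
  have hemb : MeasurableEmbedding φ := φ.isometry.isClosedEmbedding.measurableEmbedding
  have hanalytic : AnalyticOnNhd ℝ (f ∘ φ) Set.univ := fun v _ =>
    (hf (φ v) trivial).comp <|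
      ((affineSpan ℝ C).direction.subtypeL.analyticAt v).add analyticAt_const
  rw [← direction_affineSpan, euclideanHausdorffMeasure_restrict_eq_map (subset_affineSpan ℝ C)
    ⟨x, hx⟩, hemb.ae_map_iff] at hae
  have hEqOn : Set.EqOn (f ∘ φ) 0 (interior (φ ⁻¹' C)) :=
    Measure.eqOn_open_of_ae_eq (ae_restrict_of_ae_restrict_of_subset interior_subset hae)
      isOpen_interior (hanalytic.continuousOn.mono (Set.subset_univ _)) continuousOn_const
  obtain ⟨v, hv⟩ := interior_affineChart_preimage_nonempty hC ⟨x, hx⟩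
  have hzero : f ∘ φ = 0 := hanalytic.eq_of_eventuallyEq analyticOnNhd_const
    (Filter.eventually_of_mem (isOpen_interior.mem_nhds hv) hEqOn)
  simpa [φ, affineChart_apply] using congrFun hzero 0

end ConvexSets

/-! ### Tetrahedra and their faces -/

/-- The nondegenerate tetrahedra, given by their sets of vertices. -/
structure IsTetrahedron (T : Finset E3) : Prop where
  affineIndependent : AffineIndependent ℝ ((↑) : T → E3)
  card_eq : T.card = 4

theorem hull_subset_affineSpan (s : Finset E3) : hull s ⊆ affineSpan ℝ (s : Set E3) :=
  convexHull_subset_affineSpan _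

theorem isCompact_hull (s : Finset E3) : IsCompact (hull s) :=
  s.finite_toSet.isCompact_convexHull ℝ

theorem finrank_vectorSpan_hull {s : Finset E3} (hs : AffineIndependent ℝ ((↑) : s → E3)) {d : ℕ}
    (hd : s.card = d + 1) : Module.finrank ℝ (vectorSpan ℝ (hull s)) = d := by
  have hrange : Set.range ((↑) : s → E3) = s := Subtype.range_coe
  rw [hull, ← direction_affineSpan, affineSpan_convexHull, direction_affineSpan, ← hrange]
  exact hs.finrank_vectorSpan (hd ▸ Fintype.card_coe s)

theorem analyticOnNhd_pval (q : Poly3) : AnalyticOnNhd ℝ (pval q) Set.univ := by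
  have hcoord (i : Fin 3) : AnalyticOnNhd ℝ (fun x : E3 => x i) Set.univ := fun x _ =>
    (EuclideanSpace.proj i : E3 →L[ℝ] ℝ).analyticAt x
  exact AnalyticOnNhd.aeval_mvPolynomial hcoord q

theorem continuous_pval (q : Poly3) : Continuous (pval q) :=
  continuousOn_univ.1 (analyticOnNhd_pval q).continuousOn

theorem pval_eq_zero_of_ae_hull {s : Finset E3} (hs : AffineIndependent ℝ ((↑) : s → E3)) {d : ℕ}
    (hd : s.card = d + 1) {q : Poly3} (h : ∀ᵐ x ∂(μHE[d]).restrict (hull s), pval q x = 0)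
    {x : E3} (hx : x ∈ affineSpan ℝ (s : Set E3)) : pval q x = 0 := by
  rw [← finrank_vectorSpan_hull hs hd] at h
  rw [← affineSpan_convexHull] at hx
  exact eq_zero_on_affineSpan_of_ae_eq_zero (convex_convexHull ℝ _) (analyticOnNhd_pval q) h hx

namespace IsTetrahedron

variable {T F : Finset E3}

theorem affineSpan_eq_top (hT : IsTetrahedron T) : affineSpan ℝ (T : Set E3) = ⊤ := by
  have h : affineSpan ℝ (Set.range ((↑) : T → E3)) = ⊤ :=
    hT.affineIndependent.affineSpan_eq_top_iff_card_eq_finrank_add_one.2 (by simp [hT.card_eq])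
  rwa [Subtype.range_coe] at h

theorem eq_zero_of_ae_hull (hT : IsTetrahedron T) {q : Poly3}
    (h : ∀ᵐ x ∂volume.restrict (hull T), pval q x = 0) : q = 0 := by
  refine eq_zero_of_forall_pval_eq_zero fun x => ?_
  rw [← EuclideanSpace.euclideanHausdorffMeasure_eq_volume 3] at h
  exact pval_eq_zero_of_ae_hull hT.affineIndependent hT.card_eq h
    (hT.affineSpan_eq_top ▸ AffineSubspace.mem_top ℝ E3 x)

theorem affineIndependent_face (hT : IsTetrahedron T) (hF : F ∈ facesOf T) :
    AffineIndependent ℝ ((↑) : F → E3) :=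
  hT.affineIndependent.mono (Finset.coe_subset.2 (Finset.mem_powersetCard.1 hF).1)

theorem pval_eq_zero_of_ae_face (hT : IsTetrahedron T) (hF : F ∈ facesOf T) {q : Poly3}
    (h : ∀ᵐ x ∂surfaceMeasure.restrict (hull F), pval q x = 0) {x : E3}
    (hx : x ∈ affineSpan ℝ (F : Set E3)) : pval q x = 0 :=
  pval_eq_zero_of_ae_hull (hT.affineIndependent_face hF) (Finset.mem_powersetCard.1 hF).2 h hx

theorem surfaceMeasure_hull_lt_top (hT : IsTetrahedron T) (hF : F ∈ facesOf T) :
    surfaceMeasure (hull F) < ⊤ := by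
  have h := euclideanHausdorffMeasure_lt_top (isCompact_hull F).isBounded
  rwa [finrank_vectorSpan_hull (hT.affineIndependent_face hF)
    (Finset.mem_powersetCard.1 hF).2] at h

theorem pval_eq_zero_of_integral_sum_sq_face {ι : Type*} [Fintype ι] (hT : IsTetrahedron T)
    (hF : F ∈ facesOf T) {v : ι → Poly3}
    (h : ∫ x in hull F, ∑ i, pval (v i) x ^ 2 ∂surfaceMeasure = 0) {x : E3}
    (hx : x ∈ affineSpan ℝ (F : Set E3)) (i : ι) : pval (v i) x = 0 := by
  have hint : IntegrableOn (fun x => ∑ i, pval (v i) x ^ 2) (hull F) surfaceMeasure :=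
    (continuous_finsetSum _ fun i _ => (continuous_pval (v i)).pow 2).continuousOn
      |>.integrableOn_of_subset_isCompact (isCompact_hull F) (isCompact_hull F).measurableSet
        subset_rfl (hT.surfaceMeasure_hull_lt_top hF).ne
  rw [integral_eq_zero_iff_of_nonneg (fun x => Finset.sum_nonneg fun i _ => sq_nonneg _) hint] at h
  refine hT.pval_eq_zero_of_ae_face hF (h.mono fun y hy => ?_) hx
  exact pow_eq_zero_iff two_ne_zero |>.1 <|
    (Finset.sum_eq_zero_iff_of_nonneg fun i _ => sq_nonneg _).1 hy i (Finset.mem_univ i)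

end IsTetrahedron

theorem mem_affineSpan_image_of_coord_eq_zero {ι k V P : Type*} [Finite ι] [Ring k]
    [Nontrivial k] [AddCommGroup V] [Module k V] [AddTorsor V P] (b : AffineBasis ι k P) {i : ι}
    {x : P} (hx : b.coord i x = 0) : x ∈ affineSpan k (b '' {i}ᶜ) := by
  have := Fintype.ofFinite ι
  rw [← b.affineCombination_coord_eq_self x]
  refine affineCombination_mem_affineSpan_image (b.sum_coord_apply_eq_one x) (fun j _ hj => ?_) b
  rwa [Set.notMem_compl_iff.1 hj]

/-- `f = 0` is the equation of the plane of the face `F` of the tetrahedron `T`, with `T` on its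
nonnegative side. -/
structure IsFaceEquation (T F : Finset E3) (f : E3 →ᵃ[ℝ] ℝ) : Prop where
  linear_ne_zero : f.linear ≠ 0
  nonneg : ∀ x ∈ hull T, 0 ≤ f x
  eq_zero : ∀ x ∈ hull F, f x = 0
  mem_affineSpan : ∀ x, f x = 0 → x ∈ affineSpan ℝ (F : Set E3)

theorem IsTetrahedron.exists_isFaceEquation {T F : Finset E3} (hT : IsTetrahedron T)
    (hF : F ∈ facesOf T) : ∃ f, IsFaceEquation T F f := by
  classical
  obtain ⟨hFT, hFcard⟩ := Finset.mem_powersetCard.1 hF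
  obtain ⟨v, hv, rfl⟩ : ∃ v ∈ T, T.erase v = F := by
    obtain ⟨v, hv⟩ := Finset.card_eq_one.1 (show (T \ F).card = 1 by
      rw [Finset.card_sdiff_of_subset hFT, hT.card_eq, hFcard])
    have hvT : v ∈ T \ F := hv ▸ Finset.mem_singleton_self v
    exact ⟨v, (Finset.mem_sdiff.1 hvT).1, by
      rw [← Finset.sdiff_singleton_eq_erase, ← hv, Finset.sdiff_sdiff_eq_self hFT]⟩
  let b : AffineBasis T ℝ E3 :=
    ⟨(↑), hT.affineIndependent, by rw [Subtype.range_coe]; exact hT.affineSpan_eq_top⟩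
  have hb : Set.range b = T := Subtype.range_coe
  have hcoord (w) (hw : w ∈ T.erase v) : b.coord ⟨v, hv⟩ w = 0 :=
    b.coord_apply_ne (i := ⟨v, hv⟩) (j := ⟨w, Finset.mem_of_mem_erase hw⟩)
      fun h => Finset.ne_of_mem_erase hw (congrArg Subtype.val h).symm
  refine ⟨b.coord ⟨v, hv⟩, fun h => ?_, fun x hx => ?_, fun x hx => ?_, fun x hx => ?_⟩
  · obtain ⟨w, hw⟩ : (T.erase v).Nonempty := Finset.card_pos.1 (by grind)
    have h1 := (b.coord ⟨v, hv⟩).linearMap_vsub v w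
    rw [hcoord w hw, h, show b.coord ⟨v, hv⟩ v = 1 from b.coord_apply_eq ⟨v, hv⟩] at h1
    simp at h1
  · rw [hull, ← hb, b.convexHull_eq_nonneg_coord] at hx
    exact hx _
  · exact convexHull_min hcoord ((convex_singleton 0).affine_preimage (b.coord ⟨v, hv⟩)) hx
  · refine affineSpan_mono ℝ ?_ (mem_affineSpan_image_of_coord_eq_zero b hx)
    rintro _ ⟨w, hw, rfl⟩
    exact Finset.mem_erase.2 ⟨fun h => hw (Subtype.ext h), w.2⟩

/-! ### Inner products on a cell -/

theorem integrableOn_pval_hull (T : Finset E3) (q : Poly3) : IntegrableOn (pval q) (hull T) :=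
  (continuous_pval q).continuousOn.integrableOn_compact (isCompact_hull T)

/-- The integral of a polynomial over a cell, as a linear functional. -/
def cellIntegral (T : Finset E3) : Poly3 →ₗ[ℝ] ℝ where
  toFun q := ∫ x in hull T, pval q x
  map_add' q r := by
    simpa only [pval, map_add] using
      integral_add (integrableOn_pval_hull T q) (integrableOn_pval_hull T r)
  map_smul' c q := by
    simpa only [pval, smul_eval, RingHom.id_apply, smul_eq_mul] using
      integral_const_mul c (pval q)

/-- The inner product `innerS` of scalar fields, as a bilinear form. -/
def innerSₗ (T : Finset E3) : Poly3 →ₗ[ℝ] Poly3 →ₗ[ℝ] ℝ :=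
  (LinearMap.mul ℝ Poly3).compr₂ (cellIntegral T)

/-- The inner product `innerV` of vector fields, as a bilinear form. -/
def innerVₗ (T : Finset E3) : (Fin 3 → Poly3) →ₗ[ℝ] (Fin 3 → Poly3) →ₗ[ℝ] ℝ :=
  ∑ i, (innerSₗ T).compl₁₂ (LinearMap.proj i) (LinearMap.proj i)

/-- The inner product `innerM` of matrix fields, as a bilinear form. -/
def innerMₗ (T : Finset E3) :
    Matrix (Fin 3) (Fin 3) Poly3 →ₗ[ℝ] Matrix (Fin 3) (Fin 3) Poly3 →ₗ[ℝ] ℝ :=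
  ∑ i, (innerVₗ T).compl₁₂ (LinearMap.proj (φ := fun _ : Fin 3 => Fin 3 → Poly3) i)
    (LinearMap.proj (φ := fun _ : Fin 3 => Fin 3 → Poly3) i)

theorem innerSₗ_apply (T : Finset E3) (p q : Poly3) : innerSₗ T p q = innerS T p q :=
  integral_congr_ae (.of_forall fun _ => map_mul _ p q)

theorem integrableOn_pval_mul_pval_hull (T : Finset E3) (p q : Poly3) :
    IntegrableOn (fun x => pval p x * pval q x) (hull T) :=
  ((continuous_pval p).mul (continuous_pval q)).continuousOn.integrableOn_compact (isCompact_hull T)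

theorem innerV_eq_sum (T : Finset E3) (u v : Fin 3 → Poly3) :
    innerV T u v = ∑ i, innerS T (u i) (v i) :=
  integral_finsetSum _ fun i _ => integrableOn_pval_mul_pval_hull T (u i) (v i)

theorem innerM_eq_sum (T : Finset E3) (L G : Matrix (Fin 3) (Fin 3) Poly3) :
    innerM T L G = ∑ i, innerV T (L i) (G i) :=
  integral_finsetSum _ fun i _ => integrable_finsetSum _ fun j _ =>
    integrableOn_pval_mul_pval_hull T (L i j) (G i j)

theorem innerVₗ_apply (T : Finset E3) (u v : Fin 3 → Poly3) : innerVₗ T u v = innerV T u v := by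
  simp only [innerV_eq_sum, ← innerSₗ_apply, innerVₗ, LinearMap.sum_apply]
  rfl

theorem innerMₗ_apply (T : Finset E3) (L G : Matrix (Fin 3) (Fin 3) Poly3) :
    innerMₗ T L G = innerM T L G := by
  simp only [innerM_eq_sum, ← innerVₗ_apply, innerMₗ, LinearMap.sum_apply]
  rfl

theorem innerV_comm (T : Finset E3) (u v : Fin 3 → Poly3) : innerV T u v = innerV T v u := by
  simp only [innerV, mul_comm]

theorem innerS_self_nonneg (T : Finset E3) (q : Poly3) : 0 ≤ innerS T q q :=
  integral_nonneg fun _ => mul_self_nonneg _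

theorem innerV_self_nonneg (T : Finset E3) (v : Fin 3 → Poly3) : 0 ≤ innerV T v v :=
  integral_nonneg fun _ => Finset.sum_nonneg fun _ _ => mul_self_nonneg _

theorem innerM_self_nonneg (T : Finset E3) (L : Matrix (Fin 3) (Fin 3) Poly3) :
    0 ≤ innerM T L L := by
  rw [innerM_eq_sum]
  exact Finset.sum_nonneg fun i _ => innerV_self_nonneg T (L i)

namespace IsTetrahedron

variable {T : Finset E3}

theorem eq_zero_of_innerS_mul_self (hT : IsTetrahedron T) {ω : Poly3} (hω : ω ≠ 0)
    (hnonneg : ∀ x ∈ hull T, 0 ≤ pval ω x) {q : Poly3} (h : innerS T (ω * q) q = 0) : q = 0 := by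
  have hint : ∫ x in hull T, pval (ω * q * q) x = 0 := (innerSₗ_apply T (ω * q) q).trans h
  have hmeas : MeasurableSet (hull T) := (isCompact_hull T).measurableSet
  rw [setIntegral_eq_zero_iff_of_nonneg_ae ?_ (integrableOn_pval_hull T _)] at hint
  · have hzero : ω * q * q = 0 := hT.eq_zero_of_ae_hull hint
    simpa [hω] using hzero
  · refine ae_restrict_of_forall_mem hmeas fun x hx => ?_
    simpa [pval, mul_assoc] using mul_nonneg (hnonneg x hx) (mul_self_nonneg (pval q x))

theorem eq_zero_of_innerV_smul_self (hT : IsTetrahedron T) {ω : Poly3} (hω : ω ≠ 0)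
    (hnonneg : ∀ x ∈ hull T, 0 ≤ pval ω x) {v : Fin 3 → Poly3} (h : innerV T (ω • v) v = 0) :
    v = 0 := by
  have hterm (i : Fin 3) : 0 ≤ innerS T ((ω • v) i) (v i) :=
    setIntegral_nonneg (isCompact_hull T).measurableSet fun x hx => by
      simpa [pval, mul_assoc] using mul_nonneg (hnonneg x hx) (mul_self_nonneg (pval (v i) x))
  rw [innerV_eq_sum, Finset.sum_eq_zero_iff_of_nonneg fun i _ => hterm i] at h
  exact funext fun i => hT.eq_zero_of_innerS_mul_self hω hnonneg (h i (Finset.mem_univ i))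

theorem eq_zero_of_innerS_self (hT : IsTetrahedron T) {q : Poly3} (h : innerS T q q = 0) :
    q = 0 :=
  hT.eq_zero_of_innerS_mul_self one_ne_zero (fun _ _ => by simp [pval]) (by rwa [one_mul])

theorem eq_zero_of_innerV_self (hT : IsTetrahedron T) {v : Fin 3 → Poly3}
    (h : innerV T v v = 0) : v = 0 :=
  hT.eq_zero_of_innerV_smul_self one_ne_zero (fun _ _ => by simp [pval]) (by rwa [one_smul])

theorem eq_zero_of_innerM_self (hT : IsTetrahedron T) {L : Matrix (Fin 3) (Fin 3) Poly3}
    (h : innerM T L L = 0) : L = 0 := by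
  rw [innerM_eq_sum, Finset.sum_eq_zero_iff_of_nonneg fun i _ => innerV_self_nonneg T (L i)] at h
  exact funext fun i => hT.eq_zero_of_innerV_self (h i (Finset.mem_univ i))

end IsTetrahedron

/-! ### Boundary pairings -/

/-- The boundary data on a cell that are integrable on each face. -/
def integrableTraces (T : Finset E3) : Submodule ℝ (E3 → E3) where
  carrier := {lam | ∀ F ∈ facesOf T, IntegrableOn lam (hull F) surfaceMeasure}
  add_mem' h k F hF := (h F hF).add (k F hF)
  zero_mem' _ _ := integrableOn_zero
  smul_mem' c _ h F hF := (h F hF).smul c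

section BoundaryIntegral

variable {T : Finset E3} {g h : Finset E3 → E3 → ℝ}

theorem boundaryIntegral_add (hg : ∀ F ∈ facesOf T, IntegrableOn (g F) (hull F) surfaceMeasure)
    (hh : ∀ F ∈ facesOf T, IntegrableOn (h F) (hull F) surfaceMeasure) :
    boundaryIntegral T (fun F x => g F x + h F x) =
      boundaryIntegral T g + boundaryIntegral T h := by
  simp only [boundaryIntegral, ← Finset.sum_add_distrib]
  exact Finset.sum_congr rfl fun F hF => integral_add (hg F hF) (hh F hF)

theorem boundaryIntegral_const_mul (c : ℝ) :
    boundaryIntegral T (fun F x => c * g F x) = c * boundaryIntegral T g := by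
  simp only [boundaryIntegral, integral_const_mul, Finset.mul_sum]

theorem boundaryIntegral_eq_zero
    (hg : ∀ F ∈ facesOf T, ∀ᵐ x ∂surfaceMeasure.restrict (hull F), g F x = 0) :
    boundaryIntegral T g = 0 :=
  Finset.sum_eq_zero fun F hF => integral_eq_zero_of_ae (hg F hF)

end BoundaryIntegral

theorem integrableOn_trace_mul {T F : Finset E3} {lam : E3 → E3} (hlam : lam ∈ integrableTraces T)
    (hF : F ∈ facesOf T) (v : Fin 3 → Poly3) :
    IntegrableOn (fun x => ∑ i, lam x i * pval (v i) x) (hull F) surfaceMeasure :=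
  integrable_finsetSum _ fun i _ => IntegrableOn.mul_continuousOn
    ((EuclideanSpace.proj i : E3 →L[ℝ] ℝ).integrable_comp (hlam F hF))
    (continuous_pval _).continuousOn (isCompact_hull F)

/-- The pairing `⟪lam, g⟫_∂T`, where `g` is a vector polynomial on each face, as a bilinear form. -/
def tracePairing (T : Finset E3) :
    integrableTraces T →ₗ[ℝ] (Finset E3 → Fin 3 → Poly3) →ₗ[ℝ] ℝ :=
  LinearMap.mk₂ ℝ (fun lam g => boundaryIntegral T fun F x => ∑ i, lam.1 x i * pval (g F i) x)
    (fun lam mu g => by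
      rw [← boundaryIntegral_add (fun F hF => integrableOn_trace_mul lam.2 hF _)
        (fun F hF => integrableOn_trace_mul mu.2 hF _)]
      simp [add_mul, Finset.sum_add_distrib])
    (fun c lam g => by
      rw [smul_eq_mul, ← boundaryIntegral_const_mul]
      simp [Finset.mul_sum, mul_assoc])
    (fun lam g h => by
      rw [← boundaryIntegral_add (fun F hF => integrableOn_trace_mul lam.2 hF _)
        (fun F hF => integrableOn_trace_mul lam.2 hF _)]
      simp [pval, mul_add, Finset.sum_add_distrib])
    (fun c lam g => by
      rw [smul_eq_mul, ← boundaryIntegral_const_mul]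
      simp [pval, Finset.mul_sum, mul_left_comm])

theorem tracePairing_apply {T : Finset E3} (lam : integrableTraces T)
    (g : Finset E3 → Fin 3 → Poly3) :
    tracePairing T lam g = boundaryIntegral T fun F x => ∑ i, lam.1 x i * pval (g F i) x :=
  rfl

/-- The boundary values of a vector polynomial on a tetrahedron. -/
def polyTrace {T : Finset E3} (hT : IsTetrahedron T) :
    (Fin 3 → Poly3) →ₗ[ℝ] integrableTraces T where
  toFun u := ⟨fun x => WithLp.toLp 2 fun i => pval (u i) x, fun F hF => by
    have hcont : Continuous fun x : E3 => WithLp.toLp 2 fun i => pval (u i) x :=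
      (PiLp.continuous_toLp 2 _).comp (continuous_pi fun i => continuous_pval (u i))
    exact hcont.continuousOn.integrableOn_of_subset_isCompact (isCompact_hull F)
      (isCompact_hull F).measurableSet subset_rfl (hT.surfaceMeasure_hull_lt_top hF).ne⟩
  map_add' u v := by ext; simp [pval]
  map_smul' c u := by ext; simp [pval]

/-- The normal trace `G ν` of a matrix field. -/
def normalTrace (T : Finset E3) :
    Matrix (Fin 3) (Fin 3) Poly3 →ₗ[ℝ] Finset E3 → Fin 3 → Poly3 where
  toFun G F i := ∑ j, outerNormal T F j • G i j
  map_add' G H := by ext1 F; ext1 i; simp [Finset.sum_add_distrib]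
  map_smul' c G := by ext1 F; ext1 i; simp [Finset.smul_sum, smul_comm c]

/-- The trace `q ν` of a scalar field. -/
def scalarNormalTrace (T : Finset E3) : Poly3 →ₗ[ℝ] Finset E3 → Fin 3 → Poly3 where
  toFun q F i := outerNormal T F i • q
  map_add' q r := by ext1 F; ext1 i; simp
  map_smul' c q := by ext1 F; ext1 i; simp [smul_comm c]

/-- The trace `S v` of a vector field, where `S` is the stabilization of the method `m`. -/
def stabTrace (m : Method) (T : Finset E3) :
    (Fin 3 → Poly3) →ₗ[ℝ] Finset E3 → Fin 3 → Poly3 :=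
  LinearMap.pi fun F => m.stab T F • LinearMap.id

theorem tracePairing_normalTrace {T : Finset E3} (lam : integrableTraces T)
    (G : Matrix (Fin 3) (Fin 3) Poly3) :
    tracePairing T lam (normalTrace T G) = boundaryIntegral T fun F x =>
      ∑ i, lam.1 x i * ∑ j, pval (G i j) x * outerNormal T F j := by
  simp [tracePairing_apply, normalTrace, pval, mul_comm]

theorem tracePairing_scalarNormalTrace {T : Finset E3} (lam : integrableTraces T) (q : Poly3) :
    tracePairing T lam (scalarNormalTrace T q) = boundaryIntegral T fun F x =>
      (∑ i, lam.1 x i * outerNormal T F i) * pval q x := by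
  simp [tracePairing_apply, scalarNormalTrace, pval, Finset.sum_mul, mul_assoc]

theorem tracePairing_stabTrace {T : Finset E3} (hT : IsTetrahedron T) (m : Method)
    (u v : Fin 3 → Poly3) (lam : integrableTraces T) :
    tracePairing T (polyTrace hT u - lam) (stabTrace m T v) = boundaryIntegral T fun F x =>
      ∑ i, m.stab T F * (pval (u i) x - lam.1 x i) * pval (v i) x := by
  rw [tracePairing_apply]
  simp [stabTrace, polyTrace, pval, mul_left_comm, mul_assoc]

/-! ### Unique solvability of the local problems -/

theorem exists_forall_mem_eq_of_nondegenerate {K E : Type*} [Field K] [AddCommGroup E] [Module K E]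
    {S : Submodule K E} (hS : S.FG) {b : E →ₗ[K] E →ₗ[K] K}
    (hb : ∀ x ∈ S, (∀ y ∈ S, b x y = 0) → x = 0) (f : E →ₗ[K] K) :
    ∃ x ∈ S, ∀ y ∈ S, b x y = f y := by
  have : FiniteDimensional K S := Module.Finite.iff_fg.2 hS
  have hinj : Function.Injective (b.domRestrict₁₂ S S) :=
    (injective_iff_map_eq_zero _).2 fun x hx =>
      Subtype.ext (hb x x.2 fun y hy => LinearMap.congr_fun hx ⟨y, hy⟩)
  obtain ⟨x, hx⟩ := (LinearMap.injective_iff_surjective_of_finrank_eq_finrank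
    Subspace.dual_finrank_eq.symm).1 hinj (f.domRestrict S)
  exact ⟨x, x.2, fun y hy => LinearMap.congr_fun hx ⟨y, hy⟩⟩

/-- The product space `W × V × Q` in which a method looks for the local solutions. -/
def Method.space (m : Method) :
    Submodule ℝ (Matrix (Fin 3) (Fin 3) Poly3 × (Fin 3 → Poly3) × Poly3) :=
  m.W.prod (m.V.prod m.Q)

section LocalProblem

variable {T : Finset E3} {m : Method} {dt : ℝ} {lam : E3 → E3} {s t : LocalTriple}

/-- The bilinear form of the local problem: the sum of the left-hand sides of its three equations,
without the boundary data. -/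
def localForm (hT : IsTetrahedron T) (m : Method) (dt : ℝ) :
    Matrix (Fin 3) (Fin 3) Poly3 × (Fin 3 → Poly3) × Poly3 →ₗ[ℝ]
      Matrix (Fin 3) (Fin 3) Poly3 × (Fin 3 → Poly3) × Poly3 →ₗ[ℝ] ℝ :=
  LinearMap.mk₂ ℝ (fun x y =>
    innerMₗ T x.1 y.1 + innerVₗ T x.2.1 (divergenceₗ y.1) +
      (innerVₗ T (-divergenceₗ x.1 + gradₗ x.2.2) y.2.1 +
        tracePairing T (polyTrace hT x.2.1) (stabTrace m T y.2.1)) +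
      (1 / dt * innerSₗ T x.2.2 y.2.2 - innerVₗ T x.2.1 (gradₗ y.2.2)))
    (fun x x' y => by simp; ring)
    (fun c x y => by simp; ring)
    (fun x y y' => by simp; ring)
    (fun c x y => by simp; ring)

/-- The boundary data of the local problem, as a functional of the test functions. -/
def localData (m : Method) (lam : integrableTraces T) :
    Matrix (Fin 3) (Fin 3) Poly3 × (Fin 3 → Poly3) × Poly3 →ₗ[ℝ] ℝ :=
  tracePairing T lam ∘ₗ
    (normalTrace T).coprod ((stabTrace m T).coprod (-scalarNormalTrace T))

theorem isLocalSolution_iff (hT : IsTetrahedron T) (hlam : lam ∈ integrableTraces T) :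
    IsLocalSolution m dt T lam s ↔ (s.L, s.u, s.p) ∈ m.space ∧
      ∀ y ∈ m.space, localForm hT m dt (s.L, s.u, s.p) y = localData m ⟨lam, hlam⟩ y := by
  constructor
  · refine fun h => ⟨⟨h.L_mem, h.u_mem, h.p_mem⟩, ?_⟩
    rintro ⟨G, v, q⟩ ⟨hG, hv, hq⟩
    have h1 := h.gradient_eq G hG
    have h2 := h.momentum_eq v hv
    have h3 := h.balance_eq q hq
    rw [← tracePairing_normalTrace ⟨lam, hlam⟩, ← innerMₗ_apply, ← innerVₗ_apply] at h1
    rw [← tracePairing_stabTrace hT m s.u v ⟨lam, hlam⟩, ← innerVₗ_apply, map_sub,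
      LinearMap.sub_apply, add_sub, sub_eq_zero] at h2
    rw [← tracePairing_scalarNormalTrace ⟨lam, hlam⟩, ← innerSₗ_apply, ← innerVₗ_apply] at h3
    simp only [localForm, localData, LinearMap.mk₂_apply, divergenceₗ_apply, gradₗ_apply, h1, h2,
      h3, LinearMap.comp_apply, LinearMap.coprod_apply, LinearMap.neg_apply,
      map_add (tracePairing T _), map_neg (tracePairing T _)]
    ring
  · rintro ⟨⟨hL, hu, hp⟩, h⟩
    refine ⟨hL, hu, hp, fun G hG => ?_, fun v hv => ?_, fun q hq => ?_⟩
    · rw [← tracePairing_normalTrace ⟨lam, hlam⟩, ← innerMₗ_apply, ← innerVₗ_apply]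
      simpa [localForm, localData, ← divergenceₗ_apply, ← gradₗ_apply] using
        h (G, 0, 0) ⟨hG, zero_mem _, zero_mem _⟩
    · rw [← tracePairing_stabTrace hT m s.u v ⟨lam, hlam⟩, ← innerVₗ_apply, map_sub,
        LinearMap.sub_apply, add_sub, sub_eq_zero]
      simpa [localForm, localData, ← divergenceₗ_apply, ← gradₗ_apply] using
        h (0, v, 0) ⟨zero_mem _, hv, zero_mem _⟩
    · rw [← tracePairing_scalarNormalTrace ⟨lam, hlam⟩, ← innerSₗ_apply, ← innerVₗ_apply]
      simpa [localForm, localData, ← divergenceₗ_apply, ← gradₗ_apply] using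
        h (0, 0, q) ⟨zero_mem _, zero_mem _, hq⟩

theorem localData_zero : localData m (⟨0, zero_mem _⟩ : integrableTraces T) = 0 := by
  change tracePairing T 0 ∘ₗ _ = 0
  rw [map_zero, LinearMap.zero_comp]

theorem IsLocalSolution.sub (hT : IsTetrahedron T) (hlam : lam ∈ integrableTraces T)
    (hs : IsLocalSolution m dt T lam s) (ht : IsLocalSolution m dt T lam t) :
    IsLocalSolution m dt T 0 ⟨s.L - t.L, s.u - t.u, s.p - t.p⟩ := by
  obtain ⟨hs_mem, hs⟩ := (isLocalSolution_iff hT hlam).1 hs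
  obtain ⟨ht_mem, ht⟩ := (isLocalSolution_iff hT hlam).1 ht
  refine (isLocalSolution_iff hT (zero_mem _)).2 ⟨sub_mem hs_mem ht_mem, fun y hy => ?_⟩
  change localForm hT m dt ((s.L, s.u, s.p) - (t.L, t.u, t.p)) y = _
  rw [map_sub, LinearMap.sub_apply, hs y hy, ht y hy, sub_self, localData_zero,
    LinearMap.zero_apply]

theorem existsUnique_isLocalSolution (hT : IsTetrahedron T) (hfg : m.space.FG)
    (h0 : ∀ s, IsLocalSolution m dt T 0 s → s = ⟨0, 0, 0⟩) (hlam : lam ∈ integrableTraces T) :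
    ∃! s, IsLocalSolution m dt T lam s := by
  have hnondeg : ∀ x ∈ m.space, (∀ y ∈ m.space, localForm hT m dt x y = 0) → x = 0 := by
    rintro ⟨L, u, p⟩ hx hxy
    have hs : IsLocalSolution m dt T 0 ⟨L, u, p⟩ :=
      (isLocalSolution_iff hT (zero_mem _)).2 ⟨hx, fun y hy => by
        rw [hxy y hy, localData_zero, LinearMap.zero_apply]⟩
    cases h0 _ hs
    rfl
  obtain ⟨x, hx, hxy⟩ :=
    exists_forall_mem_eq_of_nondegenerate hfg hnondeg (localData m ⟨lam, hlam⟩)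
  have hs : IsLocalSolution m dt T lam ⟨x.1, x.2.1, x.2.2⟩ :=
    (isLocalSolution_iff hT hlam).2 ⟨hx, hxy⟩
  refine ⟨_, hs, fun t ht => ?_⟩
  have hdiff := h0 _ (ht.sub hT hlam hs)
  simp only [LocalTriple.mk.injEq, sub_eq_zero] at hdiff
  obtain ⟨hL, hu, hp⟩ := hdiff
  cases t
  simp_all only

end LocalProblem

/-! ### Comparison of the methods -/

/-- The method without stabilization whose velocities are arbitrary polynomial fields. It leaves the
velocity undetermined, but it determines `L` and `p`. -/
def freeVelocity (p : ℕ) : Method where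
  W := rowwise (vecPolySpace p)
  V := ⊤
  Q := polySpace p
  stab _ _ := 0

namespace IsLocalSolution

variable {T : Finset E3} {m : Method} {dt : ℝ} {lam : E3 → E3} {s t : LocalTriple} {p : ℕ} {τ : ℝ}
  {Fstar : Finset E3 → Finset E3}

theorem divergence_eq_grad (hT : IsTetrahedron T) (hs : IsLocalSolution m dt T lam s) {ω : Poly3}
    (hω : ω ≠ 0) (hnonneg : ∀ x ∈ hull T, 0 ≤ pval ω x)
    (hstab : ∀ F ∈ facesOf T, m.stab T F = 0 ∨ ∀ x ∈ hull F, pval ω x = 0)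
    (hmem : ω • (-divergence s.L + grad s.p) ∈ m.V) : divergence s.L = grad s.p := by
  have hmomentum := hs.momentum_eq _ hmem
  rw [boundaryIntegral_eq_zero fun F hF => ?_, add_zero, innerV_comm] at hmomentum
  · exact neg_add_eq_zero.1 (hT.eq_zero_of_innerV_smul_self hω hnonneg hmomentum)
  · refine ae_restrict_of_forall_mem (isCompact_hull F).measurableSet fun x hx => ?_
    obtain h | h := hstab F hF
    · simp [h]
    · have hzero : eval (fun i => x i) ω = 0 := h x hx
      simp [pval, hzero]

theorem freeVelocity_of_divergence_eq_grad (hs : IsLocalSolution m dt T lam s)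
    (hW : rowwise (vecPolySpace p) ≤ m.W) (hQ : polySpace p ≤ m.Q)
    (hL : s.L ∈ rowwise (vecPolySpace p)) (hp : s.p ∈ polySpace p)
    (h : divergence s.L = grad s.p) : IsLocalSolution (freeVelocity p) dt T lam s where
  L_mem := hL
  u_mem := Submodule.mem_top
  p_mem := hp
  gradient_eq G hG := hs.gradient_eq G (hW hG)
  momentum_eq v _ := by simp [h, freeVelocity, innerV, boundaryIntegral, pval]
  balance_eq q hq := hs.balance_eq q (hQ hq)

theorem divergence_eq_grad_of_freeVelocity (hT : IsTetrahedron T)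
    (hs : IsLocalSolution (freeVelocity p) dt T lam s) : divergence s.L = grad s.p :=
  hs.divergence_eq_grad hT one_ne_zero (fun _ _ => by simp [pval]) (fun _ _ => .inl rfl)
    Submodule.mem_top

theorem eq_zero_of_freeVelocity (hT : IsTetrahedron T) (hdt : 0 < dt)
    (hs : IsLocalSolution (freeVelocity p) dt T 0 s) : s.L = 0 ∧ s.p = 0 := by
  have hgradient := hs.gradient_eq s.L hs.L_mem
  have hbalance := hs.balance_eq s.p hs.p_mem
  rw [boundaryIntegral_eq_zero fun F _ => .of_forall fun x => by simp] at hgradient hbalance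
  rw [hs.divergence_eq_grad_of_freeVelocity hT] at hgradient
  have henergy : innerM T s.L s.L + 1 / dt * innerS T s.p s.p = 0 := by linarith
  have hLnonneg := innerM_self_nonneg T s.L
  have hpnonneg := mul_nonneg (one_div_pos.2 hdt).le (innerS_self_nonneg T s.p)
  have hp : 1 / dt * innerS T s.p s.p = 0 := by linarith only [henergy, hLnonneg, hpnonneg]
  exact ⟨hT.eq_zero_of_innerM_self (by linarith only [henergy, hp]),
    hT.eq_zero_of_innerS_self ((mul_eq_zero.1 hp).resolve_left (one_div_pos.2 hdt).ne')⟩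

theorem eq_of_freeVelocity (hT : IsTetrahedron T) (hdt : 0 < dt) (hlam : lam ∈ integrableTraces T)
    (hs : IsLocalSolution (freeVelocity p) dt T lam s)
    (ht : IsLocalSolution (freeVelocity p) dt T lam t) : s.L = t.L ∧ s.p = t.p := by
  simpa only [sub_eq_zero] using (hs.sub hT hlam ht).eq_zero_of_freeVelocity hT hdt

theorem freeVelocity_of_bdmH (hT : IsTetrahedron T) (hs : IsLocalSolution (bdmH p) dt T lam s) :
    IsLocalSolution (freeVelocity p) dt T lam s :=
  hs.freeVelocity_of_divergence_eq_grad le_rfl le_rfl hs.L_mem hs.p_mem <|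
    hs.divergence_eq_grad hT one_ne_zero (fun _ _ => by simp [pval]) (fun _ _ => .inl rfl) <| by
      rw [one_smul]
      exact add_mem (neg_mem (divergence_mem_vecPolySpace hs.L_mem))
        (grad_mem_vecPolySpace hs.p_mem)

theorem freeVelocity_of_rtH (hT : IsTetrahedron T) (hs : IsLocalSolution (rtH p) dt T lam s) :
    IsLocalSolution (freeVelocity p) dt T lam s := by
  have hgrad : grad s.p ∈ vecPolySpace (p - 1) := grad_mem_vecPolySpace hs.p_mem
  have h : divergence s.L = grad s.p :=
    hs.divergence_eq_grad hT one_ne_zero (fun _ _ => by simp [pval]) (fun _ _ => .inl rfl) <| by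
      rw [one_smul]
      exact add_mem (neg_mem (divergence_mem_of_raviartThomas hs.L_mem))
        (vecPolySpace_mono (by lia) hgrad)
  have hL : s.L ∈ rowwise (vecPolySpace p) := fun i =>
    mem_vecPolySpace_of_vecDivergence_mem (hs.L_mem i) (mem_vecPolySpace.1 (h ▸ hgrad) i)
  exact hs.freeVelocity_of_divergence_eq_grad (rowwise_mono le_sup_left) le_rfl hL hs.p_mem h

theorem freeVelocity_of_sfh (hT : IsTetrahedron T) (hF : Fstar T ∈ facesOf T)
    (hs : IsLocalSolution (sfh p τ Fstar) dt T lam s) :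
    IsLocalSolution (freeVelocity p) dt T lam s := by
  obtain ⟨f, hf⟩ := hT.exists_isFaceEquation hF
  refine hs.freeVelocity_of_divergence_eq_grad le_rfl le_rfl hs.L_mem hs.p_mem <|
    hs.divergence_eq_grad hT (affinePoly_ne_zero hf.linear_ne_zero)
      (fun x hx => pval_affinePoly f x ▸ hf.nonneg x hx) (fun F _ => ?_) ?_
  · obtain rfl | hne := eq_or_ne F (Fstar T)
    · exact .inr fun x hx => by rw [pval_affinePoly, hf.eq_zero x hx]
    · exact .inl (if_neg hne)
  · refine mem_vecPolySpace.2 fun i => ?_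
    have hmem := add_mem (neg_mem (divergence_mem_vecPolySpace hs.L_mem))
      (grad_mem_vecPolySpace hs.p_mem)
    simpa using mul_mem_polySpace (affinePoly_mem_polySpace f) (mem_vecPolySpace.1 hmem i)

theorem velocity_eq_zero (hT : IsTetrahedron T) {u : Fin 3 → Poly3}
    (hs : IsLocalSolution m dt T 0 ⟨0, u, 0⟩) (hdiv : ∀ v ∈ m.V, ∃ G ∈ m.W, divergence G = v) :
    u = 0 := by
  obtain ⟨G, hG, rfl⟩ := hdiv u hs.u_mem
  have hgradient := hs.gradient_eq G hG
  rw [boundaryIntegral_eq_zero fun F _ => .of_forall fun x => by simp] at hgradient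
  refine hT.eq_zero_of_innerV_self ?_
  simpa [innerM, pval] using hgradient

theorem sfh_velocity_eq (hT : IsTetrahedron T) (hF : Fstar T ∈ facesOf T) (hτ : τ ≠ 0)
    (hs : IsLocalSolution (sfh p τ Fstar) dt T lam s) {q : Fin 3 → Poly3} (hq : q ∈ vecPolySpace p)
    (hlam : ∀ᵐ x ∂surfaceMeasure.restrict (hull (Fstar T)), ∀ i, lam x i = pval (q i) x)
    {x : E3} (hx : x ∈ affineSpan ℝ (Fstar T : Set E3)) (i : Fin 3) :
    pval (s.u i) x = pval (q i) x := by
  have hdiv := (hs.freeVelocity_of_sfh hT hF).divergence_eq_grad_of_freeVelocity hT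
  have hmomentum := hs.momentum_eq (s.u - q) (sub_mem hs.u_mem hq)
  have hcell : innerV T (-divergence s.L + grad s.p) (s.u - q) = 0 := by
    simp [hdiv, innerV, pval]
  have hface : ∫ x in hull (Fstar T), ∑ i, τ * (pval (s.u i) x - lam x i) *
      pval ((s.u - q) i) x ∂surfaceMeasure = 0 := by
    rw [hcell, zero_add, boundaryIntegral, Finset.sum_eq_single_of_mem _ hF fun F _ hne => ?_]
      at hmomentum
    · simpa [sfh] using hmomentum
    · simp [sfh, hne]
  have hsq : τ * ∫ x in hull (Fstar T), ∑ i, pval ((s.u - q) i) x ^ 2 ∂surfaceMeasure = 0 := by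
    rw [← hface, ← integral_const_mul]
    refine integral_congr_ae (hlam.mono fun x hx => ?_)
    simp [hx, pval, Finset.mul_sum, sq, mul_assoc]
  simpa [pval, sub_eq_zero] using
    hT.pval_eq_zero_of_integral_sum_sq_face hF ((mul_eq_zero.1 hsq).resolve_left hτ) hx i

theorem velocity_eq_zero_of_sfh (hT : IsTetrahedron T) (hF : Fstar T ∈ facesOf T) (hτ : τ ≠ 0)
    {u : Fin 3 → Poly3} (hs : IsLocalSolution (sfh p τ Fstar) dt T 0 ⟨0, u, 0⟩) : u = 0 := by
  obtain ⟨f, hf⟩ := hT.exists_isFaceEquation hF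
  have hdvd (i : Fin 3) : affinePoly f ∣ u i :=
    affinePoly_dvd hf.linear_ne_zero fun x hx => by
      simpa [pval] using hs.sfh_velocity_eq hT hF hτ (zero_mem _)
        (.of_forall fun y j => by simp [pval]) (hf.mem_affineSpan x hx) i
  choose w hw using hdvd
  obtain rfl : u = affinePoly f • w := funext hw
  have hwmem : w ∈ vecPolySpace (p - 1) := mem_vecPolySpace.2 fun i =>
    mem_polySpace_of_affinePoly_mul_mem hf.linear_ne_zero (mem_vecPolySpace.1 hs.u_mem i)
  obtain ⟨G, hG, rfl⟩ := exists_divergence_eq (fun _ => radialField_mem_vecPolySpace) hwmem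
  have hgradient := hs.gradient_eq G hG
  rw [boundaryIntegral_eq_zero fun F _ => .of_forall fun x => by simp] at hgradient
  have hw0 : divergence G = 0 :=
    hT.eq_zero_of_innerV_smul_self (affinePoly_ne_zero hf.linear_ne_zero)
      (fun x hx => pval_affinePoly f x ▸ hf.nonneg x hx)
      (by simpa [innerM, pval] using hgradient)
  rw [hw0, smul_zero]

end IsLocalSolution

/-! ### The three methods on a tetrahedron -/

/-- The three methods that are compared. -/
def hybridMethods (p : ℕ) (τ : ℝ) (Fstar : Finset E3 → Finset E3) : Set Method :=
  {bdmH p, rtH p, sfh p τ Fstar}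

section Tetrahedron

variable {T : Finset E3} {m m' : Method} {dt : ℝ} {lam : E3 → E3} {s : LocalTriple} {p : ℕ}
  {τ : ℝ} {Fstar : Finset E3 → Finset E3}

theorem fg_space_of_mem_hybridMethods (hm : m ∈ hybridMethods p τ Fstar) : m.space.FG := by
  obtain rfl | rfl | rfl := hm
  · exact (rowwise_fg (vecPolySpace_fg _)).prod ((vecPolySpace_fg _).prod (polySpace_fg _))
  · exact (rowwise_fg (raviartThomas_fg _)).prod ((vecPolySpace_fg _).prod (polySpace_fg _))
  · exact (rowwise_fg (vecPolySpace_fg _)).prod ((vecPolySpace_fg _).prod (polySpace_fg _))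

theorem IsLocalSolution.freeVelocity_of_mem (hT : IsTetrahedron T) (hF : Fstar T ∈ facesOf T)
    (hm : m ∈ hybridMethods p τ Fstar) (hs : IsLocalSolution m dt T lam s) :
    IsLocalSolution (freeVelocity p) dt T lam s := by
  obtain rfl | rfl | rfl := hm
  · exact hs.freeVelocity_of_bdmH hT
  · exact hs.freeVelocity_of_rtH hT
  · exact hs.freeVelocity_of_sfh hT hF

theorem IsLocalSolution.eq_zero (hT : IsTetrahedron T) (hF : Fstar T ∈ facesOf T) (hdt : 0 < dt)
    (hτ : τ ≠ 0) (hm : m ∈ hybridMethods p τ Fstar) (hs : IsLocalSolution m dt T 0 s) :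
    s = ⟨0, 0, 0⟩ := by
  obtain ⟨L, u, q⟩ := s
  obtain ⟨rfl, rfl⟩ : L = 0 ∧ q = 0 := (hs.freeVelocity_of_mem hT hF hm).eq_zero_of_freeVelocity
    hT hdt
  suffices hu : u = 0 by rw [hu]
  obtain rfl | rfl | rfl := hm
  · exact hs.velocity_eq_zero hT fun v =>
      exists_divergence_eq fun _ => radialField_mem_vecPolySpace
  · exact hs.velocity_eq_zero hT fun v =>
      exists_divergence_eq fun _ => radialField_mem_raviartThomas
  · exact hs.velocity_eq_zero_of_sfh hT hF hτ

theorem existsUnique_isLocalSolution_of_mem (hT : IsTetrahedron T) (hF : Fstar T ∈ facesOf T)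
    (hdt : 0 < dt) (hτ : τ ≠ 0) (hm : m ∈ hybridMethods p τ Fstar)
    (hlam : lam ∈ integrableTraces T) : ∃! s, IsLocalSolution m dt T lam s :=
  existsUnique_isLocalSolution hT (fg_space_of_mem_hybridMethods hm)
    (fun _ hs => hs.eq_zero hT hF hdt hτ hm) hlam

theorem isLocalSolution_localSolver (hT : IsTetrahedron T) (hF : Fstar T ∈ facesOf T)
    (hdt : 0 < dt) (hτ : τ ≠ 0) (hm : m ∈ hybridMethods p τ Fstar)
    (hlam : lam ∈ integrableTraces T) : IsLocalSolution m dt T lam (localSolver m dt T lam) :=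
  Classical.epsilon_spec (existsUnique_isLocalSolution_of_mem hT hF hdt hτ hm hlam).exists

theorem localSolver_L_eq_and_p_eq (hT : IsTetrahedron T) (hF : Fstar T ∈ facesOf T) (hdt : 0 < dt)
    (hτ : τ ≠ 0) (hm : m ∈ hybridMethods p τ Fstar) (hm' : m' ∈ hybridMethods p τ Fstar)
    (hlam : lam ∈ integrableTraces T) :
    (localSolver m dt T lam).L = (localSolver m' dt T lam).L ∧
      (localSolver m dt T lam).p = (localSolver m' dt T lam).p :=
  ((isLocalSolution_localSolver hT hF hdt hτ hm hlam).freeVelocity_of_mem hT hF hm)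
    |>.eq_of_freeVelocity hT hdt hlam
      ((isLocalSolution_localSolver hT hF hdt hτ hm' hlam).freeVelocity_of_mem hT hF hm')

end Tetrahedron

/-! ### The three methods on a mesh -/

variable {Ω : Set E3} {mesh : TetMesh Ω}

theorem isTetrahedron_of_mem_cells {T : Finset E3} (hT : T ∈ mesh.cells) : IsTetrahedron T := by
  obtain ⟨hmem, hcard⟩ := Finset.mem_filter.1 hT
  exact ⟨mesh.complex.indep (mesh.finite.mem_toFinset.1 hmem), hcard⟩

theorem facesOf_subset_faces {T : Finset E3} (hT : T ∈ mesh.cells) : facesOf T ⊆ mesh.faces := by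
  intro F hF
  obtain ⟨hFT, hFcard⟩ := Finset.mem_powersetCard.1 hF
  have hTmem := mesh.finite.mem_toFinset.1 (Finset.mem_filter.1 hT).1
  have hFne : F.Nonempty := Finset.card_pos.1 (by lia)
  exact Finset.mem_filter.2
    ⟨mesh.finite.mem_toFinset.2 (mesh.complex.down_closed hTmem hFT hFne), hFcard⟩

/-- The boundary data that are polynomial of degree at most `p` on each face of the mesh. -/
def IsFacewisePolynomial (mesh : TetMesh Ω) (p : ℕ) (lam : E3 → E3) : Prop :=
  ∀ F ∈ mesh.faces, ∃ q ∈ vecPolySpace p,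
    ∀ᵐ x ∂surfaceMeasure.restrict (hull F), ∀ i, lam x i = pval (q i) x

variable {p : ℕ} {dt : ℝ} {τ : ℝ} {Fstar : Finset E3 → Finset E3} {lam mu : E3 → E3}
  {m m' : Method}

theorem IsFacewisePolynomial.mem_integrableTraces (hlam : IsFacewisePolynomial mesh p lam)
    {T : Finset E3} (hT : T ∈ mesh.cells) : lam ∈ integrableTraces T := by
  intro F hF
  obtain ⟨q, -, hq⟩ := hlam F (facesOf_subset_faces hT hF)
  refine ((polyTrace (isTetrahedron_of_mem_cells hT) q).2 F hF).congr (hq.mono fun x hx => ?_)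
  ext i
  exact (hx i).symm

theorem stabilizationTerm_eq_zero (hdt : 0 < dt) (hτ : τ ≠ 0)
    (hFstar : ∀ T ∈ mesh.cells, Fstar T ∈ facesOf T) (hm : m ∈ hybridMethods p τ Fstar)
    (hlam : IsFacewisePolynomial mesh p lam) : stabilizationTerm mesh m dt lam mu = 0 := by
  refine Finset.sum_eq_zero fun T hT => boundaryIntegral_eq_zero fun F hF => ?_
  have hsol := isLocalSolution_localSolver (isTetrahedron_of_mem_cells hT) (hFstar T hT) hdt hτ hm
    (hlam.mem_integrableTraces hT)
  obtain rfl | rfl | rfl := hm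
  · exact .of_forall fun x => by simp [bdmH]
  · exact .of_forall fun x => by simp [rtH]
  · obtain rfl | hne := eq_or_ne F (Fstar T)
    · obtain ⟨q, hq, hlamq⟩ := hlam _ (facesOf_subset_faces hT hF)
      filter_upwards [hlamq, ae_restrict_mem (isCompact_hull _).measurableSet] with x hx hxF
      have htrace := hsol.sfh_velocity_eq (isTetrahedron_of_mem_cells hT) hF hτ hq hlamq
        (hull_subset_affineSpan _ hxF)
      simp [hx, htrace]
    · exact .of_forall fun x => by simp [sfh, hne]

theorem aForm_eq (hdt : 0 < dt) (hτ : τ ≠ 0) (hFstar : ∀ T ∈ mesh.cells, Fstar T ∈ facesOf T)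
    (hm : m ∈ hybridMethods p τ Fstar) (hm' : m' ∈ hybridMethods p τ Fstar)
    (hlam : IsFacewisePolynomial mesh p lam) (hmu : ∀ T ∈ mesh.cells, mu ∈ integrableTraces T) :
    aForm mesh m dt lam mu = aForm mesh m' dt lam mu := by
  have heq {T} (hT : T ∈ mesh.cells) {ν : E3 → E3} (hν : ν ∈ integrableTraces T) :=
    localSolver_L_eq_and_p_eq (isTetrahedron_of_mem_cells hT) (hFstar T hT) hdt hτ hm hm' hν
  have hlam' {T} (hT : T ∈ mesh.cells) := heq hT (hlam.mem_integrableTraces hT)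
  have hmu' {T} (hT : T ∈ mesh.cells) := heq hT (hmu T hT)
  have hgradient : gradientTerm mesh m dt lam mu = gradientTerm mesh m' dt lam mu :=
    Finset.sum_congr rfl fun T hT => by rw [(hlam' hT).1, (hmu' hT).1]
  have hpressure : pressureTerm mesh m dt lam mu = pressureTerm mesh m' dt lam mu :=
    Finset.sum_congr rfl fun T hT => by rw [(hlam' hT).2, (hmu' hT).2]
  rw [aForm, aForm, hgradient, hpressure, stabilizationTerm_eq_zero hdt hτ hFstar hm hlam,
    stabilizationTerm_eq_zero hdt hτ hFstar hm' hlam]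

end StokesHDG

end

open StokesHDG in
theorem mainTheorem3_general {Ω : Set E3} (mesh : TetMesh Ω) (p : ℕ) (dt : ℝ) (hdt : 0 < dt)
    (τ : ℝ) (hτ : τ ≠ 0) (Fstar : Finset E3 → Finset E3)
    (hFstar : ∀ T ∈ mesh.cells, Fstar T ∈ facesOf T) :
    (∀ m ∈ hybridMethods p τ Fstar, ∀ T ∈ mesh.cells, ∀ lam ∈ integrableTraces T,
      ∃! s : LocalTriple, IsLocalSolution m dt T lam s) ∧
    (∀ T ∈ mesh.cells, ∀ lam ∈ integrableTraces T,
      (localSolver (bdmH p) dt T lam).L = (localSolver (rtH p) dt T lam).L ∧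
      (localSolver (rtH p) dt T lam).L = (localSolver (sfh p τ Fstar) dt T lam).L ∧
      (localSolver (bdmH p) dt T lam).p = (localSolver (rtH p) dt T lam).p ∧
      (localSolver (rtH p) dt T lam).p = (localSolver (sfh p τ Fstar) dt T lam).p) ∧
    (∀ m ∈ hybridMethods p τ Fstar, ∀ lam, IsFacewisePolynomial mesh p lam →
      ∀ mu, stabilizationTerm mesh m dt lam mu = 0) ∧
    (∀ lam, IsFacewisePolynomial mesh p lam →
      ∀ mu, (∀ T ∈ mesh.cells, mu ∈ integrableTraces T) →
        aForm mesh (bdmH p) dt lam mu = aForm mesh (rtH p) dt lam mu ∧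
        aForm mesh (rtH p) dt lam mu = aForm mesh (sfh p τ Fstar) dt lam mu) := by
  have hbdm : bdmH p ∈ hybridMethods p τ Fstar := .inl rfl
  have hrt : rtH p ∈ hybridMethods p τ Fstar := .inr (.inl rfl)
  have hsfh : sfh p τ Fstar ∈ hybridMethods p τ Fstar := .inr (.inr rfl)
  refine ⟨fun m hm T hT lam => existsUnique_isLocalSolution_of_mem
      (isTetrahedron_of_mem_cells hT) (hFstar T hT) hdt hτ hm,
    fun T hT lam hlam => ?_,
    fun m hm lam hlam mu => stabilizationTerm_eq_zero hdt hτ hFstar hm hlam,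
    fun lam hlam mu hmu => ⟨aForm_eq hdt hτ hFstar hbdm hrt hlam hmu,
      aForm_eq hdt hτ hFstar hrt hsfh hlam hmu⟩⟩
  have hsolver {m m'} (hm : m ∈ hybridMethods p τ Fstar) (hm' : m' ∈ hybridMethods p τ Fstar) :=
    localSolver_L_eq_and_p_eq (isTetrahedron_of_mem_cells hT) (hFstar T hT) hdt hτ hm hm' hlam
  exact ⟨(hsolver hbdm hrt).1, (hsolver hrt hsfh).1, (hsolver hbdm hrt).2, (hsolver hrt hsfh).2⟩

theorem mainTheorem3 {Ω : Set StokesHDG.E3} (mesh : StokesHDG.TetMesh Ω) (p : ℕ)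
    (dt : ℝ) (hdt : 0 < dt) (τ : ℝ) (hτ : 0 < τ)
    (Fstar : Finset StokesHDG.E3 → Finset StokesHDG.E3)
    (hFstar : ∀ T ∈ mesh.cells, Fstar T ∈ StokesHDG.facesOf T) :
    -- the element-local problems of all three methods are uniquely solvable
    (∀ m ∈ ({StokesHDG.bdmH p, StokesHDG.rtH p, StokesHDG.sfh p τ Fstar} : Set StokesHDG.Method),
      ∀ lam ∈ StokesHDG.traceSpace mesh p, ∀ T ∈ mesh.cells,
        ∃! s : StokesHDG.LocalTriple, StokesHDG.IsLocalSolution m dt T lam s) ∧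
    -- the local solvers give the same gradient and the same pressure
    (∀ lam ∈ StokesHDG.traceSpace mesh p, ∀ T ∈ mesh.cells,
      (StokesHDG.localSolver (StokesHDG.bdmH p) dt T lam).L =
        (StokesHDG.localSolver (StokesHDG.rtH p) dt T lam).L ∧
      (StokesHDG.localSolver (StokesHDG.rtH p) dt T lam).L =
        (StokesHDG.localSolver (StokesHDG.sfh p τ Fstar) dt T lam).L ∧
      (StokesHDG.localSolver (StokesHDG.bdmH p) dt T lam).p =
        (StokesHDG.localSolver (StokesHDG.rtH p) dt T lam).p ∧
      (StokesHDG.localSolver (StokesHDG.rtH p) dt T lam).p =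
        (StokesHDG.localSolver (StokesHDG.sfh p τ Fstar) dt T lam).p) ∧
    -- the stabilization term vanishes
    (∀ m ∈ ({StokesHDG.bdmH p, StokesHDG.rtH p, StokesHDG.sfh p τ Fstar} : Set StokesHDG.Method),
      ∀ lam ∈ StokesHDG.traceSpace mesh p, ∀ mu ∈ StokesHDG.traceSpace mesh p,
        StokesHDG.stabilizationTerm mesh m dt lam mu = 0) ∧
    -- the bilinear forms coincide
    (∀ lam ∈ StokesHDG.traceSpace mesh p, ∀ mu ∈ StokesHDG.traceSpace mesh p,
      StokesHDG.aForm mesh (StokesHDG.bdmH p) dt lam mu =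
        StokesHDG.aForm mesh (StokesHDG.rtH p) dt lam mu ∧
      StokesHDG.aForm mesh (StokesHDG.rtH p) dt lam mu =
        StokesHDG.aForm mesh (StokesHDG.sfh p τ Fstar) dt lam mu) := by
  obtain ⟨hunique, hsolver, hstab, hform⟩ :=
    mainTheorem3_general mesh p dt hdt τ hτ.ne' Fstar hFstar
  have htrace {lam} (hlam : lam ∈ StokesHDG.traceSpace mesh p) {T} (hT : T ∈ mesh.cells) :=
    StokesHDG.IsFacewisePolynomial.mem_integrableTraces hlam.1 hT
  exact ⟨fun m hm lam hlam T hT => hunique m hm T hT lam (htrace hlam hT),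
    fun lam hlam T hT => hsolver T hT lam (htrace hlam hT),
    fun m hm lam hlam mu _ => hstab m hm lam hlam.1 mu,
    fun lam hlam mu hmu => hform lam hlam.1 mu fun _ => htrace hmu⟩
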